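/- Let $(R,\mathfrak m)$ be a Noetherian local ring of dimension $d\ge 1$ with infinite residue field. For an ideal $J$ of $R$ let $\nu(J)$ denote its minimal number of generators, and let $\lambda$ denote length of $R$-modules. Let $I$ be an $\mathfrak m$-primary ideal which is an almost complete intersection, that is, $\nu(I)=\operatorname{height}(I)+1=d+1$. A minimal reduction of $I$ is an ideal $Q=(a_1,\dots,a_d)\subseteq I$ generated by $d$ elements such that $I^{k+1}=QI^k$ for some integer $k\ge 0$; the least such $k$ is denoted $\mathrm r_Q(I)$, and $\mathrm r(I)=\inf\{\mathrm r_Q(I) : Q \text{ is a minimal reduction of } I\}$. Let $Q$ be a minimal reduction of $I$. If $\lambda(I^n/QI^{n-1})=1$ for some integer $n\ge 1$, then $$\mathrm r(I)\le n\,\nu(\mathfrak m)-1 .$$ -/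

import Mathlib

/-- `I` is `𝔪`-primary: its radical is the maximal ideal (which forces `I` to be primary). -/
def IsMPrimary {R : Type*} [CommRing R] [IsLocalRing R] (I : Ideal R) : Prop :=
  I.radical = IsLocalRing.maximalIdeal R

/-- The minimal number of generators of an ideal. -/
noncomputable def idealNu {R : Type*} [CommRing R] (I : Ideal R) : ℕ :=
  Submodule.spanFinrank I

/-- `I` is an almost complete intersection: it is minimally generated by `height I + 1` elements.
For an `𝔪`-primary ideal of a Noetherian local ring, the height is the dimension of the ring. -/
def IsAlmostCompleteIntersection {R : Type*} [CommRing R] (I : Ideal R) : Prop :=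
  (idealNu I : ℕ∞) = I.height + 1

/-- `Q` is a minimal reduction of the (`𝔪`-primary) ideal `I`: `Q ⊆ I` is generated by
`d = dim R` elements and `I ^ (k + 1) = Q * I ^ k` for some `k ≥ 0`. -/
def IsMinimalReduction {R : Type*} [CommRing R] (Q I : Ideal R) : Prop :=
  Q ≤ I ∧
  (∃ d : ℕ, ringKrullDim R = d ∧ ∃ a : Fin d → R, Q = Ideal.span (Set.range a)) ∧
  ∃ k : ℕ, I ^ (k + 1) = Q * I ^ k

/-- The reduction number of `I` relative to `Q`: the least `k ≥ 0` with `I ^ (k + 1) = Q * I ^ k`.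
Such a `k` exists when `Q` is a minimal reduction of `I`. -/
noncomputable def relReductionNumber {R : Type*} [CommRing R] (Q I : Ideal R) : ℕ :=
  sInf {k : ℕ | I ^ (k + 1) = Q * I ^ k}

/-- The reduction number of `I`: the least reduction number of `I` relative to its minimal
reductions. (The infimum is over a nonempty set as soon as `I` has a minimal reduction.) -/
noncomputable def reductionNumber {R : Type*} [CommRing R] (I : Ideal R) : ℕ :=
  sInf {r : ℕ | ∃ Q : Ideal R, IsMinimalReduction Q I ∧ r = relReductionNumber Q I}

/-! Write `I = Q + (x)` and let `s` be the number of generators of `𝔪`. Since the quotient has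
length one, `𝔪 I^n ⊆ Q I^(n-1)`, and two cases arise (`IdealReduction.exists_pow_eq_mul`).

If `𝔪 I^n` is not inside `𝔪 Q I^(n-1)`, an element of the difference is the value at `(x, a)` of a
form of degree `n` that is nonzero modulo `𝔪`: a nontrivial relation in the fibre cone. As the
residue field is infinite, a point where the reduced form does not vanish yields a reduction by `d`
elements with reduction number at most `n - 1` (`exists_pow_eq_mul_of_eval_mem`).

Otherwise `x^n z_i = ∑ c_ij z_j` for generators `z_i` of `𝔪`, with `c_ij ∈ Q I^(n-1)`. Once `det
(x^n - c) = 0`, expanding it gives `x^(ns) ∈ Q I^(ns-1)`, hence `I^(ns) = Q I^(ns-1)`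
(`pow_mul_mem_of_forall_mul_mem`).

The adjugate only shows that this determinant is killed by `𝔪`. It vanishes in any positive
dimension, without a depth assumption, because it lies in every `𝔪^N`
(`IsLocalRing.det_eq_zero_of_mulVec_eq_zero`). To see this, pass to `R/𝔪^(N+1)` and present it as a
quotient of `V[X]` with `V` a discrete valuation ring (`CohenRing.exists_hom`). Lift the matrix to
`A'` and put `f = A' X`. The kernel contains `f` and an element `τ - y` with `y ∈ (X)`; these `s +
1` elements cut out a zero-dimensional complete intersection in which the elements killed by all
`X_j` are generated over `V` by `det A'`. A nonzero element of `𝔪^N` has a lift with a multiple of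
this kind that is nonzero there, so it is a unit of `V` times `det A'`; mapping back puts the
determinant in `𝔪^N` (`PurePower.det_mem_pow_of_mulVec_eq_zero`). -/

section

open MvPolynomial

/-! ### Normal forms and socle modulo polynomials with leading forms `X_i ^ M`. -/

namespace PurePower

variable {σ V : Type*} [CommRing V]

/-- Polynomials all of whose monomials have degree less than `d`. -/
def degLT (σ V : Type*) [CommRing V] (d : ℕ) : Submodule V (MvPolynomial σ V) where
  carrier := {p | ∀ m : σ →₀ ℕ, d ≤ m.degree → coeff m p = 0}
  zero_mem' := fun _ _ => coeff_zero _
  add_mem' := fun {a b} ha hb m hm => by rw [coeff_add, ha m hm, hb m hm, add_zero]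
  smul_mem' := fun c x hx m hm => by rw [coeff_smul, hx m hm, smul_zero]

theorem mem_degLT {d : ℕ} {p : MvPolynomial σ V} :
    p ∈ degLT σ V d ↔ ∀ m : σ →₀ ℕ, d ≤ m.degree → coeff m p = 0 := Iff.rfl

theorem degLT_mono {d e : ℕ} (h : d ≤ e) : degLT σ V d ≤ degLT σ V e :=
  fun _ hp m hm => hp m (h.trans hm)

theorem mem_degLT_of_totalDegree_lt {d : ℕ} {p : MvPolynomial σ V} (h : p.totalDegree < d) :
    p ∈ degLT σ V d := fun m hm => by
  apply coeff_eq_zero_of_totalDegree_lt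
  exact h.trans_le hm

theorem eq_zero_of_mem_degLT_zero {p : MvPolynomial σ V} (h : p ∈ degLT σ V 0) : p = 0 := by
  ext m; simpa using h m (Nat.zero_le _)

theorem exists_mem_degLT (p : MvPolynomial σ V) : ∃ d, p ∈ degLT σ V d :=
  ⟨p.totalDegree + 1, mem_degLT_of_totalDegree_lt (Nat.lt_succ_self _)⟩

theorem mul_mem_degLT {d e : ℕ} {p q : MvPolynomial σ V} (hp : p ∈ degLT σ V (d + 1))
    (hq : q ∈ degLT σ V e) : p * q ∈ degLT σ V (d + e) := by
  classical
  intro m hm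
  rw [coeff_mul]
  refine Finset.sum_eq_zero fun x hx => ?_
  rw [Finset.HasAntidiagonal.mem_antidiagonal] at hx
  have hdeg : x.1.degree + x.2.degree = m.degree := by rw [← hx, map_add]
  by_cases h1 : e ≤ x.2.degree
  · rw [hq _ h1, mul_zero]
  · rw [hp _ (by lia), zero_mul]

/-- `p` has degree at most `d`, with homogeneous part `p₀` in degree `d`. -/
def HasLead (p p₀ : MvPolynomial σ V) (d : ℕ) : Prop :=
  p₀.IsHomogeneous d ∧ p - p₀ ∈ degLT σ V d

theorem IsHomogeneous.mem_degLT {p : MvPolynomial σ V} {d : ℕ} (h : p.IsHomogeneous d) :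
    p ∈ degLT σ V (d + 1) := fun m hm => by
  by_contra hc
  have := h hc
  have h2 : Finsupp.weight 1 m = m.degree := by
    rw [Finsupp.degree_eq_weight_one]; rfl
  lia

theorem HasLead.mem_degLT {p p₀ : MvPolynomial σ V} {d : ℕ} (h : HasLead p p₀ d) :
    p ∈ degLT σ V (d + 1) := by
  have := add_mem (degLT_mono (Nat.le_succ d) h.2) (IsHomogeneous.mem_degLT h.1)
  simpa using this

theorem HasLead.mul {p p₀ q q₀ : MvPolynomial σ V} {d e : ℕ} (hp : HasLead p p₀ d)
    (hq : HasLead q q₀ e) : HasLead (p * q) (p₀ * q₀) (d + e) := by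
  refine ⟨hp.1.mul hq.1, ?_⟩
  have h : p * q - p₀ * q₀ = p * (q - q₀) + q₀ * (p - p₀) := by ring
  rw [h]
  refine add_mem (mul_mem_degLT hp.mem_degLT hq.2) ?_
  rw [add_comm d e]
  exact mul_mem_degLT (IsHomogeneous.mem_degLT hq.1) hp.2

theorem HasLead.one : HasLead (1 : MvPolynomial σ V) 1 0 :=
  ⟨isHomogeneous_one σ V, by simp⟩

theorem HasLead.pow {p p₀ : MvPolynomial σ V} {d : ℕ} (hp : HasLead p p₀ d) (n : ℕ) :
    HasLead (p ^ n) (p₀ ^ n) (n * d) := by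
  induction n with
  | zero => simpa using HasLead.one
  | succ n ih => simpa [pow_succ, Nat.succ_mul] using ih.mul hp

theorem HasLead.prod {ι : Type*} (s : Finset ι) {p p₀ : ι → MvPolynomial σ V} {d : ι → ℕ}
    (h : ∀ i ∈ s, HasLead (p i) (p₀ i) (d i)) :
    HasLead (∏ i ∈ s, p i) (∏ i ∈ s, p₀ i) (∑ i ∈ s, d i) := by
  classical
  induction s using Finset.induction_on with
  | empty => simpa using HasLead.one
  | insert a s ha ih =>
    rw [Finset.prod_insert ha, Finset.prod_insert ha, Finset.sum_insert ha]
    exact (h a (Finset.mem_insert_self _ _)).mul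
      (ih fun i hi => h i (Finset.mem_insert_of_mem hi))

theorem HasLead.sum {ι : Type*} (s : Finset ι) {p p₀ : ι → MvPolynomial σ V} {d : ℕ}
    (h : ∀ i ∈ s, HasLead (p i) (p₀ i) d) :
    HasLead (∑ i ∈ s, p i) (∑ i ∈ s, p₀ i) d := by
  refine ⟨IsHomogeneous.sum _ _ _ fun i hi => (h i hi).1, ?_⟩
  rw [← Finset.sum_sub_distrib]
  exact sum_mem fun i hi => (h i hi).2

theorem HasLead.smul {p p₀ : MvPolynomial σ V} {d : ℕ} (hp : HasLead p p₀ d) (c : V) :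
    HasLead (c • p) (c • p₀) d := by
  refine ⟨?_, ?_⟩
  · rw [smul_eq_C_mul]; simpa using (isHomogeneous_C σ c).mul hp.1
  · rw [← smul_sub]; exact Submodule.smul_mem _ _ hp.2

theorem HasLead.X (i : σ) : HasLead (X i : MvPolynomial σ V) (X i) 1 :=
  ⟨isHomogeneous_X V i, by simp⟩

theorem coeff_X_mul_add_single (i : σ) (γ : σ →₀ ℕ) (p : MvPolynomial σ V) :
    coeff (γ + Finsupp.single i 1) (X i * p) = coeff γ p := by
  rw [add_comm, coeff_X_mul]

variable [Fintype σ]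

/-- The product `∏ fᵢ ^ (βᵢ / M) * Xᵢ ^ (βᵢ % M)`. -/
noncomputable def standardProd (f : σ → MvPolynomial σ V) (M : ℕ) (β : σ →₀ ℕ) :
    MvPolynomial σ V :=
  ∏ i, f i ^ (β i / M) * X i ^ (β i % M)

variable {f : σ → MvPolynomial σ V} {M : ℕ}

theorem hasLead_standardProd (hf : ∀ i, HasLead (f i) (X i ^ M) M) (β : σ →₀ ℕ) :
    HasLead (standardProd f M β) (monomial β 1) β.degree := by
  have h := HasLead.prod Finset.univ (p := fun i => f i ^ (β i / M) * X i ^ (β i % M))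
    (p₀ := fun i => (X i ^ M) ^ (β i / M) * X i ^ (β i % M))
    (d := fun i => (β i / M) * M + (β i % M) * 1)
    (fun i _ => ((hf i).pow _).mul ((HasLead.X i).pow _))
  have e1 : (∏ i, (X i ^ M) ^ (β i / M) * X i ^ (β i % M) : MvPolynomial σ V) = monomial β 1 := by
    rw [monomial_eq, Finsupp.prod_fintype _ _ (by simp), C_1, one_mul]
    refine Finset.prod_congr rfl fun i _ => ?_
    rw [← pow_mul, ← pow_add, Nat.div_add_mod]
  have e2 : ∑ i, ((β i / M) * M + (β i % M) * 1) = β.degree := by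
    rw [Finsupp.degree_eq_sum]
    refine Finset.sum_congr rfl fun i _ => ?_
    rw [mul_one, Nat.div_add_mod']
  rw [e1, e2] at h
  exact h

theorem standardProd_add_single (hM : 0 < M) (β : σ →₀ ℕ) (i : σ) :
    standardProd f M (β + Finsupp.single i M) = f i * standardProd f M β := by
  classical
  unfold standardProd
  rw [← Finset.mul_prod_erase _ _ (Finset.mem_univ i),
    ← Finset.mul_prod_erase Finset.univ (fun j => f j ^ (β j / M) * X j ^ (β j % M))
      (Finset.mem_univ i), ← mul_assoc]
  congr 1
  · simp only [Finsupp.add_apply, Finsupp.single_eq_same, Nat.add_mod_right,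
      Nat.add_div_right _ hM, pow_succ]
    ring
  · refine Finset.prod_congr rfl fun j hj => ?_
    rw [Finsupp.add_apply, Finsupp.single_eq_of_ne (Finset.ne_of_mem_erase hj), add_zero]

theorem standardProd_of_lt (β : σ →₀ ℕ) (h : ∀ i, β i < M) :
    standardProd f M β = monomial β 1 := by
  rw [standardProd, monomial_eq, Finsupp.prod_fintype _ _ (by simp), C_1, one_mul]
  refine Finset.prod_congr rfl fun i _ => ?_
  rw [Nat.div_eq_of_lt (h i), Nat.mod_eq_of_lt (h i), pow_zero, one_mul]

/-- The linear endomorphism sending the monomial `X ^ β` to `standardProd f M β`. -/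
noncomputable def standardMap (f : σ → MvPolynomial σ V) (M : ℕ) :
    MvPolynomial σ V →ₗ[V] MvPolynomial σ V :=
  (basisMonomials σ V).constr V (standardProd f M)

theorem standardMap_monomial (β : σ →₀ ℕ) :
    standardMap f M (monomial β 1) = standardProd f M β := by
  have := (basisMonomials σ V).constr_basis V (standardProd f M) β
  simpa [standardMap] using this

theorem standardMap_apply (p : MvPolynomial σ V) :
    standardMap f M p = ∑ m ∈ p.support, coeff m p • standardProd f M m := by
  conv_lhs => rw [p.as_sum]
  rw [map_sum]
  refine Finset.sum_congr rfl fun m _ => ?_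
  rw [← standardMap_monomial, ← map_smul, smul_monomial, smul_eq_mul, mul_one]

/-- Unitriangularity: each `standardProd` has the corresponding monomial as its leading form, so the
map is the identity up to lower degree. Bijectivity follows by induction on degree. -/
theorem standardMap_sub_mem (hf : ∀ i, HasLead (f i) (X i ^ M) M) {d : ℕ}
    {p : MvPolynomial σ V} (hp : p ∈ degLT σ V (d + 1)) :
    standardMap f M p - p ∈ degLT σ V d := by
  have : standardMap f M p - p =
      ∑ m ∈ p.support, coeff m p • (standardProd f M m - monomial m 1) := by
    rw [standardMap_apply]
    conv_lhs => rw [p.as_sum]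
    simp only [smul_sub, Finset.sum_sub_distrib, smul_monomial, smul_eq_mul, mul_one]
    rw [← p.as_sum]
  rw [this]
  refine sum_mem fun m hm => Submodule.smul_mem _ _ ?_
  refine degLT_mono ?_ (hasLead_standardProd hf m).2
  by_contra hc
  exact (mem_support_iff.mp hm) (hp m (by lia))

theorem mem_degLT_of_standardMap (hf : ∀ i, HasLead (f i) (X i ^ M) M) {d : ℕ}
    {p : MvPolynomial σ V} (hp : standardMap f M p ∈ degLT σ V d) : p ∈ degLT σ V d := by
  obtain ⟨e, he⟩ := exists_mem_degLT p
  induction e with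
  | zero => rw [eq_zero_of_mem_degLT_zero he]; exact zero_mem _
  | succ e ih =>
    by_cases hde : e + 1 ≤ d
    · exact degLT_mono hde he
    · refine ih ?_
      have h1 := standardMap_sub_mem hf he
      have h2 := sub_mem (degLT_mono (by lia) hp) h1
      simpa using h2

theorem standardMap_bijective (hf : ∀ i, HasLead (f i) (X i ^ M) M) :
    Function.Bijective (standardMap f M) := by
  constructor
  · rw [← LinearMap.ker_eq_bot, LinearMap.ker_eq_bot']
    intro p hp
    refine eq_zero_of_mem_degLT_zero (mem_degLT_of_standardMap hf ?_)
    rw [hp]; exact zero_mem _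
  · intro q
    obtain ⟨d, hd⟩ := exists_mem_degLT q
    induction d generalizing q with
    | zero => exact ⟨0, by rw [eq_zero_of_mem_degLT_zero hd, map_zero]⟩
    | succ d ih =>
      obtain ⟨r, hr⟩ := ih _ (standardMap_sub_mem hf hd)
      exact ⟨q - r, by rw [map_sub, hr]; abel⟩

/-- `standardMap` as a linear automorphism. -/
noncomputable def standardEquiv (hf : ∀ i, HasLead (f i) (X i ^ M) M) :
    MvPolynomial σ V ≃ₗ[V] MvPolynomial σ V :=
  LinearEquiv.ofBijective _ (standardMap_bijective hf)

theorem standardMap_symm (hf : ∀ i, HasLead (f i) (X i ^ M) M) (t : MvPolynomial σ V) :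
    standardMap f M ((standardEquiv hf).symm t) = t :=
  (standardEquiv hf).apply_symm_apply t

theorem symm_standardMap (hf : ∀ i, HasLead (f i) (X i ^ M) M) (t : MvPolynomial σ V) :
    (standardEquiv hf).symm (standardMap f M t) = t :=
  (standardEquiv hf).symm_apply_apply t

theorem symm_sub_mem (hf : ∀ i, HasLead (f i) (X i ^ M) M) {d : ℕ}
    {t : MvPolynomial σ V} (ht : t ∈ degLT σ V (d + 1)) :
    (standardEquiv hf).symm t - t ∈ degLT σ V d := by
  have h : (standardEquiv hf).symm t ∈ degLT σ V (d + 1) :=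
    mem_degLT_of_standardMap hf (by rwa [standardMap_symm])
  have := standardMap_sub_mem hf h
  rw [standardMap_symm] at this
  rw [← neg_sub]
  exact neg_mem this

/-- Together with bijectivity, this transports the ideal `(f_i)` to the monomial ideal `(X_i ^ M)`,
where membership is read off from coefficients. -/
theorem standardMap_X_pow_mul (hM : 0 < M) (i : σ) (p : MvPolynomial σ V) :
    standardMap f M (X i ^ M * p) = f i * standardMap f M p := by
  induction p using MvPolynomial.induction_on' with
  | monomial u a =>
    rw [show (monomial u a : MvPolynomial σ V) = a • monomial u 1 by
        rw [smul_monomial, smul_eq_mul, mul_one],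
      mul_smul_comm, map_smul, map_smul, mul_smul_comm, X_pow_eq_monomial, monomial_mul,
      standardMap_monomial, one_mul, add_comm (Finsupp.single i M) u, standardMap_monomial,
      standardProd_add_single hM]
  | add p q hp hq => rw [mul_add, map_add, map_add, mul_add, hp, hq]

theorem symm_mul (hf : ∀ i, HasLead (f i) (X i ^ M) M) (hM : 0 < M) (i : σ)
    (p : MvPolynomial σ V) :
    (standardEquiv hf).symm (f i * p) = X i ^ M * (standardEquiv hf).symm p := by
  conv_lhs => rw [← standardMap_symm hf p]
  rw [← standardMap_X_pow_mul hM, symm_standardMap]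

theorem standardProd_mem (hM : 0 < M) {β : σ →₀ ℕ} (h : ¬ ∀ i, β i < M) :
    standardProd f M β ∈ Ideal.span (Set.range f) := by
  push Not at h
  obtain ⟨i, hi⟩ := h
  have : β = (β - Finsupp.single i M) + Finsupp.single i M := by
    rw [tsub_add_cancel_of_le]
    rwa [Finsupp.single_le_iff]
  rw [this, standardProd_add_single hM]
  exact Ideal.mul_mem_right _ _ (Ideal.subset_span ⟨i, rfl⟩)

theorem mem_span_iff (hf : ∀ i, HasLead (f i) (X i ^ M) M) (hM : 0 < M)
    (t : MvPolynomial σ V) :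
    t ∈ Ideal.span (Set.range f) ↔
      ∀ γ : σ →₀ ℕ, (∀ i, γ i < M) → coeff γ ((standardEquiv hf).symm t) = 0 := by
  constructor
  · intro ht γ hγ
    obtain ⟨c, rfl⟩ := (Ideal.mem_span_range_iff_exists_fun).mp ht
    rw [map_sum, coeff_sum]
    refine Finset.sum_eq_zero fun i _ => ?_
    rw [mul_comm, symm_mul hf hM, X_pow_eq_monomial, coeff_monomial_mul', if_neg]
    rw [Finsupp.single_le_iff]
    exact not_le.mpr (hγ i)
  · intro h
    rw [← standardMap_symm hf t, standardMap_apply]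
    refine sum_mem fun m hm => Submodule.smul_of_tower_mem _ _ (standardProd_mem hM fun hs => ?_)
    exact (mem_support_iff.mp hm) (h m hs)

/-- The quotient by `f` is free over `V` on the monomials with exponents below `M`, so regular
elements of `V` stay regular on it. -/
theorem mem_span_of_smul_mem (hf : ∀ i, HasLead (f i) (X i ^ M) M) (hM : 0 < M) {a : V}
    (ha : a ∈ nonZeroDivisors V) {t : MvPolynomial σ V}
    (h : a • t ∈ Ideal.span (Set.range f)) : t ∈ Ideal.span (Set.range f) := by
  rw [mem_span_iff hf hM] at h ⊢
  intro γ hγ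
  have := h γ hγ
  rw [map_smul, coeff_smul, smul_eq_mul, mul_comm] at this
  exact (mem_nonZeroDivisors_iff.mp ha).2 _ this

theorem exists_sub_smul_mem_iff (hf : ∀ i, HasLead (f i) (X i ^ M) M) (hM : 0 < M)
    (τ : V) (t : MvPolynomial σ V) :
    (∃ h, t - τ • h ∈ Ideal.span (Set.range f)) ↔
      ∀ γ : σ →₀ ℕ, (∀ i, γ i < M) → τ ∣ coeff γ ((standardEquiv hf).symm t) := by
  constructor
  · rintro ⟨h, hh⟩ γ hγ
    have := (mem_span_iff hf hM _).mp hh γ hγ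
    rw [map_sub, map_smul, coeff_sub, coeff_smul, sub_eq_zero] at this
    rw [this]
    exact ⟨_, rfl⟩
  · intro H
    rw [← standardMap_symm hf t, standardMap_apply]
    set p := (standardEquiv hf).symm t
    suffices h : ∀ s : Finset (σ →₀ ℕ),
        ∃ h, ∑ m ∈ s, coeff m p • standardProd f M m - τ • h ∈ Ideal.span (Set.range f) from h _
    intro s
    induction s using Finset.induction_on with
    | empty => exact ⟨0, by simp⟩
    | insert m s hm ih =>
      obtain ⟨h, hh⟩ := ih
      rw [Finset.sum_insert hm]
      by_cases hs : ∀ i, m i < M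
      · obtain ⟨c, hc⟩ := H m hs
        refine ⟨h + c • standardProd f M m, ?_⟩
        convert hh using 1
        rw [hc, mul_smul, smul_add]; abel
      · refine ⟨h, ?_⟩
        rw [add_sub_assoc]
        exact add_mem (Submodule.smul_of_tower_mem _ _ (standardProd_mem hM hs)) hh

/-- The exponent all of whose entries are `M - 1`. -/
noncomputable def topExp (σ : Type*) [Finite σ] (M : ℕ) : σ →₀ ℕ :=
  Finsupp.equivFunOnFinite.symm fun _ => M - 1

/-- If all `X j * t` vanish modulo `f` and `τ`, and the top coefficient of `t` vanishes modulo
`τ`, then `t` vanishes modulo `f` and `τ`. -/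
theorem exists_sub_smul_mem_of_X_mul (hf : ∀ i, HasLead (f i) (X i ^ M) M) (hM : 0 < M)
    (τ : V) (t : MvPolynomial σ V)
    (hX : ∀ j, ∃ h, X j * t - τ • h ∈ Ideal.span (Set.range f))
    (htop : τ ∣ coeff (topExp σ M) ((standardEquiv hf).symm t)) :
    ∃ h, t - τ • h ∈ Ideal.span (Set.range f) := by
  classical
  set p := (standardEquiv hf).symm t with hp
  -- `r` collects the terms of the normal form that survive modulo `f` and `τ`; the claim is that
  -- there are none.
  let T := p.support.filter fun m => (∀ i, m i < M) ∧ ¬ τ ∣ coeff m p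
  let r : MvPolynomial σ V := ∑ m ∈ T, monomial m (coeff m p)
  have hcr : ∀ m, coeff m r = if m ∈ T then coeff m p else 0 := by
    intro m
    simp only [r, coeff_sum, coeff_monomial]
    rw [Finset.sum_ite_eq' T m]
  have hsr : (standardEquiv hf).symm r = r := by
    have : standardMap f M r = r := by
      simp only [r, map_sum]
      refine Finset.sum_congr rfl fun m hm => ?_
      rw [show (monomial m (coeff m p) : MvPolynomial σ V) = coeff m p • monomial m 1 by
        rw [smul_monomial, smul_eq_mul, mul_one], map_smul, standardMap_monomial,
        standardProd_of_lt _ (Finset.mem_filter.mp hm).2.1]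
    conv_lhs => rw [← this]
    exact symm_standardMap hf r
  obtain ⟨h₀, hh₀⟩ : ∃ h, (t - r) - τ • h ∈ Ideal.span (Set.range f) := by
    rw [exists_sub_smul_mem_iff hf hM]
    intro γ hγ
    rw [map_sub, hsr, coeff_sub, hcr]
    split_ifs with h
    · simp [hp]
    · rw [sub_zero]
      by_contra hc
      refine h (Finset.mem_filter.mpr ⟨mem_support_iff.mpr ?_, hγ, hc⟩)
      intro h0
      exact hc (by rw [← hp, h0]; exact dvd_zero _)
  rcases T.eq_empty_or_nonempty with hT | hT
  · refine ⟨h₀, ?_⟩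
    have : r = 0 := by simp [r, hT]
    simpa [this] using hh₀
  exfalso
  obtain ⟨γ, hγT, hmax⟩ := T.exists_max_image (fun m => m.degree) hT
  have hrd : r ∈ degLT σ V (γ.degree + 1) := by
    intro m hm
    rw [hcr, if_neg]
    intro hmT
    have := hmax m hmT
    lia
  obtain ⟨-, hγs, hγτ⟩ := Finset.mem_filter.mp hγT
  -- If `γ j < M - 1`, then `γ + e_j` is still a standard exponent, and since `γ` has maximal
  -- degree, triangularity makes its coefficient in `X j * r` equal to that of `γ` in `r`. The
  -- former is divisible by `τ`, the latter is not.
  have key : ∀ j, γ j = M - 1 := by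
    intro j
    by_contra hne
    obtain ⟨h, hh⟩ := hX j
    have hXr : ∃ h, X j * r - τ • h ∈ Ideal.span (Set.range f) := by
      refine ⟨h - X j * h₀, ?_⟩
      have := sub_mem hh (Ideal.mul_mem_left _ (X j) hh₀)
      convert this using 1
      rw [smul_sub, mul_sub, mul_sub, mul_smul_comm]; abel
    rw [exists_sub_smul_mem_iff hf hM] at hXr
    have hlow := symm_sub_mem hf (d := 1 + γ.degree)
      (t := X j * r) (by
        rw [add_assoc]
        exact mul_mem_degLT (IsHomogeneous.mem_degLT (isHomogeneous_X V j)) hrd)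
    have h1 := hlow (γ + Finsupp.single j 1) (by rw [map_add, Finsupp.degree_single]; lia)
    rw [coeff_sub, coeff_X_mul_add_single, hcr, if_pos hγT, sub_eq_zero] at h1
    refine hγτ ?_
    rw [← h1]
    refine hXr _ fun i => ?_
    have hi := hγs i
    by_cases hij : j = i
    · subst hij
      rw [Finsupp.add_apply, Finsupp.single_eq_same]; lia
    · rw [Finsupp.add_apply, Finsupp.single_eq_of_ne (Ne.symm hij)]; lia
  have : γ = topExp σ M := by
    ext j
    rw [key j]; rfl
  exact hγτ (this ▸ htop)

theorem finite_quotient (hf : ∀ i, HasLead (f i) (X i ^ M) M) (hM : 0 < M) :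
    Module.Finite V (MvPolynomial σ V ⧸ Ideal.span (Set.range f)) := by
  classical
  let q : MvPolynomial σ V →ₗ[V] (MvPolynomial σ V ⧸ Ideal.span (Set.range f)) :=
    (Ideal.Quotient.mkₐ V _).toLinearMap
  have hfin : {γ : σ →₀ ℕ | ∀ i, γ i < M}.Finite := by
    refine (Set.finite_Icc 0 (topExp σ M)).subset fun γ hγ => ⟨zero_le, fun i => ?_⟩
    have := hγ i
    change γ i ≤ M - 1
    lia
  refine ⟨⟨(hfin.image fun γ => q (monomial γ 1)).toFinset, ?_⟩⟩
  rw [Set.Finite.coe_toFinset, eq_top_iff]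
  rintro x -
  obtain ⟨t, rfl⟩ := Ideal.Quotient.mk_surjective x
  change q t ∈ _
  rw [← standardMap_symm hf t, standardMap_apply, map_sum]
  refine sum_mem fun m _ => ?_
  rw [map_smul]
  refine Submodule.smul_mem _ _ ?_
  by_cases hs : ∀ i, m i < M
  · exact Submodule.subset_span ⟨m, hs, by simp only [standardProd_of_lt m hs]⟩
  · have : q (standardProd f M m) = 0 := Ideal.Quotient.eq_zero_iff_mem.mpr (standardProd_mem hM hs)
    rw [this]; exact zero_mem _

variable [DecidableEq σ] {A : Matrix σ σ (MvPolynomial σ V)}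

theorem det_mul_X_mem (hAf : A.mulVec X = f) (j : σ) :
    X j * A.det ∈ Ideal.span (Set.range f) := by
  have h : A.adjugate.mulVec f j = X j * A.det := by
    rw [← hAf, Matrix.mulVec_mulVec, Matrix.adjugate_mul, Matrix.smul_mulVec, Matrix.one_mulVec,
      Pi.smul_apply, smul_eq_mul, mul_comm]
  rw [← h, Matrix.mulVec, dotProduct]
  exact sum_mem fun i _ => Ideal.mul_mem_left _ _ (Ideal.subset_span ⟨i, rfl⟩)

theorem hasLead_det
    (hA : ∀ i j, HasLead (A i j) (Matrix.diagonal (fun i => X i ^ (M - 1)) i j) (M - 1)) :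
    HasLead A.det (monomial (topExp σ M) 1) (topExp σ M).degree := by
  have h1 : (topExp σ M).degree = ∑ _i : σ, (M - 1) := by
    rw [Finsupp.degree_eq_sum]; rfl
  have h2 : (monomial (topExp σ M) 1 : MvPolynomial σ V) =
      (Matrix.diagonal (fun i => X i ^ (M - 1))).det := by
    rw [Matrix.det_diagonal, monomial_eq, Finsupp.prod_fintype _ _ (by simp), C_1, one_mul]
    rfl
  rw [h1, h2, Matrix.det_apply', Matrix.det_apply']
  refine HasLead.sum _ fun π _ => ?_
  have h3 : ∀ q : MvPolynomial σ V, (((Equiv.Perm.sign π : ℤˣ) : ℤ) : MvPolynomial σ V) * q =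
      (((Equiv.Perm.sign π : ℤˣ) : ℤ) : V) • q := fun q => by
    rw [smul_eq_C_mul, map_intCast]
  rw [h3, h3]
  exact (HasLead.prod _ fun i _ => hA _ _).smul _

/-- The leading form of the determinant is the product of the `X_i ^ (M - 1)`, and passing to normal
form does not alter coefficients in top degree. Subtracting a multiple of the determinant can
therefore clear the top coefficient of a socle element. -/
theorem coeff_topExp_det (hf : ∀ i, HasLead (f i) (X i ^ M) M)
    (hA : ∀ i j, HasLead (A i j) (Matrix.diagonal (fun i => X i ^ (M - 1)) i j) (M - 1)) :
    coeff (topExp σ M) ((standardEquiv hf).symm A.det) = 1 := by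
  have h := hasLead_det hA
  have h1 := symm_sub_mem hf h.mem_degLT (topExp σ M) le_rfl
  have h2 := h.2 (topExp σ M) le_rfl
  rw [coeff_sub, sub_eq_zero] at h1 h2
  rw [h1, h2, coeff_monomial, if_pos rfl]

/-- The socle of the quotient by `f` and `τ` is generated by the determinant. -/
theorem exists_sub_smul_det_mem (hf : ∀ i, HasLead (f i) (X i ^ M) M) (hM : 0 < M)
    (hAf : A.mulVec X = f)
    (hA : ∀ i j, HasLead (A i j) (Matrix.diagonal (fun i => X i ^ (M - 1)) i j) (M - 1))
    (τ : V) (t : MvPolynomial σ V)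
    (hX : ∀ j, ∃ h, X j * t - τ • h ∈ Ideal.span (Set.range f)) :
    ∃ (v : V) (h : MvPolynomial σ V), t - v • A.det - τ • h ∈ Ideal.span (Set.range f) := by
  refine ⟨coeff (topExp σ M) ((standardEquiv hf).symm t), ?_⟩
  refine exists_sub_smul_mem_of_X_mul hf hM τ _ (fun j => ?_) ?_
  · obtain ⟨h, hh⟩ := hX j
    refine ⟨h, ?_⟩
    have := sub_mem hh (Submodule.smul_of_tower_mem _
      (coeff (topExp σ M) ((standardEquiv hf).symm t)) (det_mul_X_mem hAf j))
    convert this using 1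
    rw [mul_sub, mul_smul_comm]; abel
  · rw [map_sub, map_smul, coeff_sub, coeff_smul, coeff_topExp_det hf hA, smul_eq_mul, mul_one,
      sub_self]
    exact dvd_zero _

end PurePower

end

section

open MvPolynomial

namespace PurePower

/-! ### Replacing `τ` by `τ - y` in the socle computation. -/

section Socle

variable {σ V : Type*} [CommRing V] [Fintype σ] [DecidableEq σ]
  {f : σ → MvPolynomial σ V} {M : ℕ} {A : Matrix σ σ (MvPolynomial σ V)}

/-- The socle modulo `f` and a regular element `τ - ∑ pᵢ Xᵢ` is generated by the determinant. -/
theorem exists_sub_smul_det_sub_mul_mem (hf : ∀ i, HasLead (f i) (X i ^ M) M) (hM : 0 < M)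
    (hAf : A.mulVec X = f)
    (hA : ∀ i j, HasLead (A i j) (Matrix.diagonal (fun i => X i ^ (M - 1)) i j) (M - 1))
    {τ : V} (hτ : τ ∈ nonZeroDivisors V) (p : σ → MvPolynomial σ V)
    (hreg : ∀ t, (C τ - ∑ i, p i * X i) * t ∈ Ideal.span (Set.range f) →
      t ∈ Ideal.span (Set.range f))
    (t : MvPolynomial σ V)
    (hX : ∀ j, ∃ h, X j * t - (C τ - ∑ i, p i * X i) * h ∈ Ideal.span (Set.range f)) :
    ∃ (v : V) (h : MvPolynomial σ V),
      t - v • A.det - (C τ - ∑ i, p i * X i) * h ∈ Ideal.span (Set.range f) := by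
  choose u hu using hX
  set 𝔉 := Ideal.span (Set.range f)
  set y := ∑ i, p i * X i with hy
  -- Cross-multiplying the relations `X j * t ≡ (τ - y) * u j` and cancelling the regular factor `τ
  -- - y`.
  have hsw : ∀ i j, X i * u j - X j * u i ∈ 𝔉 := fun i j => by
    refine hreg _ ?_
    have := sub_mem (Ideal.mul_mem_left _ (X j) (hu i)) (Ideal.mul_mem_left _ (X i) (hu j))
    convert this using 1
    ring
  -- The correction `∑ p i * u i` absorbs `y`, turning a socle element modulo `τ - y` into one
  -- modulo `τ`.
  have h1 : ∀ j, X j * (t + ∑ i, p i * u i) - τ • u j ∈ 𝔉 := fun j => by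
    have h2 : ∑ i, p i * (X j * u i - X i * u j) ∈ 𝔉 :=
      sum_mem fun i _ => Ideal.mul_mem_left _ _ (hsw j i)
    have h3 := add_mem (hu j) h2
    convert h3 using 1
    rw [smul_eq_C_mul, mul_add, Finset.mul_sum]
    simp only [mul_sub, Finset.sum_sub_distrib]
    rw [sub_mul, hy, Finset.sum_mul]
    have : ∀ i, X j * (p i * u i) = p i * (X j * u i) := fun i => by ring
    simp only [this, ← mul_assoc]
    ring
  obtain ⟨v, w, hw⟩ := exists_sub_smul_det_mem hf hM hAf hA τ _ fun j => ⟨u j, h1 j⟩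
  refine ⟨v, w, ?_⟩
  -- Multiply `hw` by `X j`, which kills the determinant, and cancel `τ`. Substituting `u j ≡ X j *
  -- w` back into `hw` turns `τ * w` into `(τ - y) * w`.
  have h4 : ∀ j, u j - X j * w ∈ 𝔉 := fun j => by
    refine mem_span_of_smul_mem hf hM hτ ?_
    have h5 := sub_mem (add_mem (Ideal.mul_mem_left _ (X j) hw)
      (Submodule.smul_of_tower_mem _ v (det_mul_X_mem hAf j))) (h1 j)
    convert h5 using 1
    simp only [smul_eq_C_mul]
    ring
  have h6 : ∑ i, p i * (u i - X i * w) ∈ 𝔉 := sum_mem fun i _ => Ideal.mul_mem_left _ _ (h4 i)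
  have h7 := sub_mem hw h6
  convert h7 using 1
  have h8 : τ • w = C τ * w := smul_eq_C_mul _ _
  simp only [mul_sub, Finset.sum_sub_distrib]
  rw [sub_mul, hy, Finset.sum_mul, h8]
  simp only [← mul_assoc]
  ring

end Socle

/-! ### Presentation of a local ring with nilpotent maximal ideal, and the determinant. -/

section Presentation

variable {σ V R : Type*} [CommRing V] [CommRing R] [IsLocalRing R] [Fintype σ]

/-- A polynomial presentation of a local ring with nilpotent maximal ideal. -/
theorem eval₂Hom_surjective {z : σ → R}
    (hz : Ideal.span (Set.range z) = IsLocalRing.maximalIdeal R) {N : ℕ}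
    (hN : IsLocalRing.maximalIdeal R ^ N = ⊥) (φ₀ : V →+* R)
    (hφ₀ : ∀ r, ∃ v, r - φ₀ v ∈ IsLocalRing.maximalIdeal R) :
    Function.Surjective (eval₂Hom φ₀ z) := by
  have key : ∀ i r, ∃ s, r - eval₂Hom φ₀ z s ∈ IsLocalRing.maximalIdeal R ^ i := by
    intro i
    induction i with
    | zero => intro r; exact ⟨0, by simp⟩
    | succ i ih =>
      intro r
      obtain ⟨v, hv⟩ := hφ₀ r
      obtain ⟨c, hc⟩ := Ideal.mem_span_range_iff_exists_fun.mp (hz ▸ hv)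
      choose s hs using fun j => ih (c j)
      refine ⟨C v + ∑ j, s j * X j, ?_⟩
      have : r - eval₂Hom φ₀ z (C v + ∑ j, s j * X j) =
          ∑ j, (c j - eval₂Hom φ₀ z (s j)) * z j := by
        simp only [sub_mul, Finset.sum_sub_distrib, hc, map_add, map_sum, map_mul,
          eval₂Hom_X', eval₂Hom_C]
        ring
      rw [this, pow_succ]
      refine sum_mem fun j _ => Ideal.mul_mem_mul (hs j) ?_
      rw [← hz]
      exact Ideal.subset_span ⟨j, rfl⟩
  intro r
  obtain ⟨s, hs⟩ := key N r
  rw [hN, Ideal.mem_bot, sub_eq_zero] at hs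
  exact ⟨s, hs.symm⟩

/-- A matrix annihilating a system of generators of the maximal ideal, over a local ring with
`𝔪 ^ N ≠ 0 = 𝔪 ^ (N + 1)` that is covered by a discrete valuation ring modulo `𝔪`, has determinant
in `𝔪 ^ N`. -/
theorem det_mem_pow_of_mulVec_eq_zero [IsDomain V] [IsDiscreteValuationRing V] [DecidableEq σ]
    {z : σ → R} (hz : Ideal.span (Set.range z) = IsLocalRing.maximalIdeal R) {N : ℕ}
    (hN : IsLocalRing.maximalIdeal R ^ (N + 1) = ⊥)
    (hN' : IsLocalRing.maximalIdeal R ^ N ≠ ⊥) (φ₀ : V →+* R)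
    (hφ₀ : ∀ r, ∃ v, r - φ₀ v ∈ IsLocalRing.maximalIdeal R)
    {A : Matrix σ σ R} (hA : A.mulVec z = 0) :
    A.det ∈ IsLocalRing.maximalIdeal R ^ N := by
  -- Positivity of `N` is needed below for `1 + π ^ (N + k)` to be a unit, also at `k = 0`.
  rcases Nat.eq_zero_or_pos N with rfl | hN1
  · simp
  set φ : MvPolynomial σ V →+* R := eval₂Hom φ₀ z with hφ
  have hφC : ∀ v, φ (C v) = φ₀ v := fun v => eval₂Hom_C φ₀ z v
  have hφX : ∀ j, φ (X j) = z j := fun j => eval₂Hom_X' φ₀ z j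
  have hsurj : Function.Surjective φ := eval₂Hom_surjective hz hN φ₀ hφ₀
  have hzm : ∀ j, z j ∈ IsLocalRing.maximalIdeal R := fun j =>
    hz ▸ Ideal.subset_span ⟨j, rfl⟩
  have hpow : ∀ r ∈ IsLocalRing.maximalIdeal R, ∀ k, N + 1 ≤ k → r ^ k = 0 := fun r hr k hk => by
    have := Ideal.pow_le_pow_right hk (Ideal.pow_mem_pow hr k)
    rwa [hN] at this
  obtain ⟨π, hπ⟩ := IsDiscreteValuationRing.exists_irreducible V
  have hcomap : (IsLocalRing.maximalIdeal R).comap φ₀ = IsLocalRing.maximalIdeal V := by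
    refine IsLocalRing.eq_maximalIdeal ?_
    have hs : Function.Surjective ((Ideal.Quotient.mk (IsLocalRing.maximalIdeal R)).comp φ₀) := by
      intro r
      obtain ⟨r, rfl⟩ := Ideal.Quotient.mk_surjective r
      obtain ⟨v, hv⟩ := hφ₀ r
      exact ⟨v, (Ideal.Quotient.eq.mpr hv).symm⟩
    have h1 : ((⊥ : Ideal (R ⧸ IsLocalRing.maximalIdeal R)).comap
        ((Ideal.Quotient.mk (IsLocalRing.maximalIdeal R)).comp φ₀)).IsMaximal := by
      have : (⊥ : Ideal (R ⧸ IsLocalRing.maximalIdeal R)).IsMaximal :=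
        (Ideal.bot_quotient_isMaximal_iff _).mpr inferInstance
      exact Ideal.comap_isMaximal_of_surjective _ hs
    rwa [← Ideal.comap_comap, ← RingHom.ker_eq_comap_bot, Ideal.mk_ker] at h1
  have hφπ : φ₀ π ∈ IsLocalRing.maximalIdeal R := by
    have : π ∈ (IsLocalRing.maximalIdeal R).comap φ₀ := by
      rw [hcomap]; exact (IsLocalRing.mem_maximalIdeal _).mpr hπ.not_isUnit
    exact this
  -- lift the matrix and perturb it
  choose B hB using fun i j => hsurj (A i j)
  obtain ⟨e, he⟩ : ∃ e, ∀ i j, (B i j).totalDegree ≤ e :=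
    ⟨Finset.univ.sup fun i => Finset.univ.sup fun j => (B i j).totalDegree, fun i j =>
      (Finset.le_sup (f := fun j => (B i j).totalDegree) (Finset.mem_univ j)).trans
        (Finset.le_sup (f := fun i => Finset.univ.sup fun j => (B i j).totalDegree)
          (Finset.mem_univ i))⟩
  -- The first bound makes `X i ^ (M - 1)` dominate the entries of the lift; the second makes it map
  -- to `0`, so the perturbed matrix still lifts `A`.
  obtain ⟨M, hMe, hMN⟩ : ∃ M, e + 1 < M ∧ N + 2 ≤ M := ⟨e + N + 2, by lia, by lia⟩
  have hM : 0 < M := by lia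
  set A' : Matrix σ σ (MvPolynomial σ V) :=
    Matrix.of B + Matrix.diagonal fun i => X i ^ (M - 1) with hA'
  have hlead : ∀ i j,
      HasLead (A' i j) (Matrix.diagonal (fun i => X i ^ (M - 1)) i j) (M - 1) := by
    intro i j
    refine ⟨?_, ?_⟩
    · rw [Matrix.diagonal_apply]
      split_ifs
      · exact isHomogeneous_X_pow i (M - 1)
      · exact isHomogeneous_zero _ _ _
    · rw [hA', Matrix.add_apply, add_sub_cancel_right]
      exact mem_degLT_of_totalDegree_lt ((he i j).trans_lt (by lia))
  set f := A'.mulVec X with hfdef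
  have hf : ∀ i, HasLead (f i) (X i ^ M) M := by
    intro i
    have := HasLead.sum Finset.univ (p := fun j => A' i j * X j)
      fun j _ => (hlead i j).mul (HasLead.X j)
    rw [Nat.sub_add_cancel hM] at this
    have h1 : ∑ j, Matrix.diagonal (fun i => (X i : MvPolynomial σ V) ^ (M - 1)) i j * X j =
        X i ^ M := by
      rw [Finset.sum_eq_single i (fun j _ hj => by
        rw [Matrix.diagonal_apply_ne' _ hj, zero_mul]) (by simp), Matrix.diagonal_apply_eq,
        ← pow_succ, Nat.sub_add_cancel hM]
    rw [h1] at this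
    exact this
  have hmap : A'.map φ = A := by
    ext i j
    rw [Matrix.map_apply, hA', Matrix.add_apply, map_add, Matrix.of_apply, hB,
      Matrix.diagonal_apply]
    split_ifs with h
    · rw [map_pow, hφX, hpow _ (hzm i) _ (by lia), add_zero]
    · rw [map_zero, add_zero]
  have hφf : ∀ i, φ (f i) = 0 := by
    intro i
    have : A.mulVec z i = 0 := congrFun hA i
    rw [← this, ← hmap]
    simp only [hfdef, Matrix.mulVec, dotProduct, map_sum, map_mul, hφX, Matrix.map_apply]
  have hφdet : φ A'.det = A.det := by rw [RingHom.map_det, RingHom.mapMatrix_apply, hmap]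
  set 𝔉 := Ideal.span (Set.range f) with h𝔉
  have hφ𝔉 : ∀ t ∈ 𝔉, φ t = 0 := by
    have : 𝔉 ≤ RingHom.ker φ := Ideal.span_le.mpr (by rintro _ ⟨i, rfl⟩; exact hφf i)
    exact fun t ht => this ht
  -- a regular element of the kernel modulo `𝔉`
  obtain ⟨c, hc⟩ := Ideal.mem_span_range_iff_exists_fun.mp (hz ▸ hφπ)
  choose p hp using fun j => hsurj (c j)
  set y := ∑ i, p i * X i with hy
  have hφy : φ y = φ₀ π := by
    rw [← hc, hy, map_sum]
    exact Finset.sum_congr rfl fun i _ => by rw [map_mul, hp, hφX]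
  have hfin : Module.Finite V (MvPolynomial σ V ⧸ 𝔉) := finite_quotient hf hM
  obtain ⟨χ, hχ, hχy⟩ := Algebra.IsIntegral.isIntegral (R := V) (Ideal.Quotient.mk 𝔉 y)
  have hχy' : Polynomial.aeval y χ ∈ 𝔉 := by
    rw [← Ideal.Quotient.eq_zero_iff_mem, ← hχy, ← Polynomial.aeval_def]
    exact (Polynomial.aeval_algHom_apply (Ideal.Quotient.mkₐ V 𝔉) y χ).symm
  -- The uniformizers `π + π ^ (N + 1 + k)` are infinitely many and all have the image of `π`, while
  -- `χ` has finitely many roots.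
  obtain ⟨τ, hτ, hτφ, hτχ⟩ : ∃ τ : V, Irreducible τ ∧ φ₀ τ = φ₀ π ∧ χ.eval τ ≠ 0 := by
    by_contra! hcon
    have hinj : Function.Injective fun k : ℕ => π + π ^ (N + 1 + k) := by
      intro k l hkl
      have := pow_injective_of_not_isUnit hπ.not_isUnit hπ.ne_zero (add_left_cancel hkl)
      lia
    refine hχ.ne_zero (Polynomial.eq_zero_of_infinite_isRoot χ
      ((Set.infinite_range_of_injective hinj).mono ?_))
    rintro _ ⟨k, rfl⟩
    refine hcon _ ?_ ?_
    · have hu : IsUnit (1 + π ^ (N + k)) := by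
        by_contra h
        have h1 : π ^ (N + k) ∈ IsLocalRing.maximalIdeal V :=
          Ideal.pow_mem_of_mem _ ((IsLocalRing.mem_maximalIdeal _).mpr hπ.not_isUnit) _ (by lia)
        have h2 := sub_mem ((IsLocalRing.mem_maximalIdeal _).mpr h) h1
        rw [add_sub_cancel_right] at h2
        exact (IsLocalRing.mem_maximalIdeal _).mp h2 isUnit_one
      have : π + π ^ (N + 1 + k) = π * (1 + π ^ (N + k)) := by ring
      change Irreducible (π + π ^ (N + 1 + k))
      rw [this]
      exact (irreducible_mul_isUnit hu).mpr hπ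
    · simp only [map_add, map_pow]
      rw [hpow _ hφπ _ (by lia), add_zero]
  set f₀ := C τ - y with hf₀
  have hφf₀ : φ f₀ = 0 := by rw [hf₀, map_sub, hφC, hφy, hτφ, sub_self]
  -- As `χ(y) ∈ 𝔉`, the nonzero scalar `χ(τ)` is a multiple of `τ - y` modulo `𝔉`. This makes `τ -
  -- y` regular modulo `𝔉` and, further on, the quotient by `𝔞` zero-dimensional.
  obtain ⟨g, hg⟩ : f₀ ∣ C (χ.eval τ) - Polynomial.aeval y χ := by
    have h1 := Polynomial.sub_dvd_eval_sub (C τ) y (χ.map (C : V →+* MvPolynomial σ V))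
    have h2 : Polynomial.eval (C τ) (χ.map (C : V →+* MvPolynomial σ V)) = C (χ.eval τ) := by
      rw [Polynomial.eval_map, Polynomial.eval₂_at_apply]
    rw [h2, Polynomial.eval_map] at h1
    exact h1
  have hχτ : χ.eval τ ∈ nonZeroDivisors V := mem_nonZeroDivisors_of_ne_zero hτχ
  have hreg : ∀ t, f₀ * t ∈ 𝔉 → t ∈ 𝔉 := fun t ht => by
    refine mem_span_of_smul_mem hf hM hχτ ?_
    rw [smul_eq_C_mul]
    have h1 := add_mem (Ideal.mul_mem_left _ g ht) (Ideal.mul_mem_right t _ hχy')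
    convert h1 using 1
    linear_combination t * hg
  set 𝔞 : Ideal (MvPolynomial σ V) := 𝔉 ⊔ Ideal.span {f₀} with h𝔞
  have h𝔞_mem : ∀ t, t ∈ 𝔞 ↔ ∃ h, t - f₀ * h ∈ 𝔉 := fun t => by
    rw [h𝔞, sup_comm, Ideal.mem_span_singleton_sup]
    constructor
    · rintro ⟨a, b, hb, rfl⟩
      exact ⟨a, by rwa [mul_comm, add_sub_cancel_left]⟩
    · rintro ⟨h, hh⟩
      exact ⟨h, _, hh, by ring⟩
  have hφ𝔞 : ∀ t ∈ 𝔞, φ t = 0 := fun t ht => by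
    obtain ⟨h, hh⟩ := (h𝔞_mem t).mp ht
    have := hφ𝔉 _ hh
    rwa [map_sub, map_mul, hφf₀, zero_mul, sub_zero] at this
  -- an element of the socle over `𝔪 ^ N`
  obtain ⟨r, hr, hr0⟩ := Submodule.exists_mem_ne_zero_of_ne_bot hN'
  obtain ⟨x, rfl⟩ := hsurj r
  set 𝔐 := (IsLocalRing.maximalIdeal R).comap φ with h𝔐
  have hX𝔐 : ∀ j, X j ∈ 𝔐 := fun j => by
    rw [h𝔐, Ideal.mem_comap, hφX]; exact hzm j
  obtain ⟨h, hh, hhx⟩ : ∃ h, h * x ∉ 𝔞 ∧ ∀ j, X j * (h * x) ∈ 𝔞 := by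
    let K : Ideal (MvPolynomial σ V) :=
      { carrier := {u | u * x ∈ 𝔞}
        zero_mem' := by simp
        add_mem' := fun {a b} ha hb => by
          change (a + b) * x ∈ 𝔞
          rw [add_mul]; exact add_mem ha hb
        smul_mem' := fun c a ha => by
          change (c • a) * x ∈ 𝔞
          rw [smul_mul_assoc]; exact 𝔞.smul_mem c ha }
    have hK : ∀ u, u ∈ K ↔ u * x ∈ 𝔞 := fun u => Iff.rfl
    -- `K` is the colon ideal `𝔞 : x`. A prime `P` over it contains `χ(τ)`, so it contracts to the
    -- maximal ideal of `V`; by integrality over `V` it is maximal. Thus `𝔐` is minimal over `K`,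
    -- hence associated to the quotient by `K`.
    have h𝔐min : 𝔐 ∈ (Module.annihilator (MvPolynomial σ V) (MvPolynomial σ V ⧸ K)).minimalPrimes := by
      rw [Ideal.annihilator_quotient]
      refine ⟨⟨Ideal.comap_isPrime _ _, fun u hu => ?_⟩, fun P ⟨hP, hKP⟩ hP𝔐 => ?_⟩
      · rw [h𝔐, Ideal.mem_comap, IsLocalRing.mem_maximalIdeal]
        intro hunit
        have h1 := hφ𝔞 _ ((hK u).mp hu)
        rw [map_mul] at h1
        exact hr0 ((hunit.mul_right_eq_zero).mp h1)
      · have h𝔞P : 𝔞 ≤ P := fun u hu => hKP ((hK u).mpr (Ideal.mul_mem_right _ _ hu))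
        have h𝔉P : 𝔉 ≤ P := le_sup_left.trans h𝔞P
        have hχP : C (χ.eval τ) ∈ P := by
          have h1 : Polynomial.aeval y χ + f₀ * g ∈ 𝔞 :=
            add_mem (Ideal.mem_sup_left hχy') (Ideal.mul_mem_right _ _
              (Ideal.mem_sup_right (Ideal.mem_span_singleton_self _)))
          rw [← hg, add_sub_cancel] at h1
          exact h𝔞P h1
        have hP' : P.comap (C : V →+* MvPolynomial σ V) = IsLocalRing.maximalIdeal V := by
          have hprime : (P.comap (C : V →+* MvPolynomial σ V)).IsPrime := Ideal.comap_isPrime _ _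
          refine IsLocalRing.eq_maximalIdeal (Ring.DimensionLEOne.maximalOfPrime ?_ hprime)
          intro h0
          have : χ.eval τ ∈ P.comap (C : V →+* MvPolynomial σ V) := hχP
          rw [h0] at this
          exact hτχ this
        have hint : ((Ideal.Quotient.mk P).comp (C : V →+* MvPolynomial σ V)).IsIntegral := by
          have h1 : ((Ideal.Quotient.mk 𝔉).comp (C : V →+* MvPolynomial σ V)).IsIntegral :=
            fun u => Algebra.IsIntegral.isIntegral (R := V) u
          have h2 : (Ideal.Quotient.mk P).comp (C : V →+* MvPolynomial σ V) =
              (Ideal.Quotient.factor h𝔉P).comp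
                ((Ideal.Quotient.mk 𝔉).comp (C : V →+* MvPolynomial σ V)) := rfl
          rw [h2]
          exact h1.trans _ _
            (RingHom.isIntegral_of_surjective _ (Ideal.Quotient.factor_surjective h𝔉P))
        have hmax : (⊥ : Ideal (MvPolynomial σ V ⧸ P)).IsMaximal := by
          refine Ideal.isMaximal_of_isIntegral_of_isMaximal_comap' _ hint ⊥ ?_
          rw [← Ideal.comap_comap, ← RingHom.ker_eq_comap_bot, Ideal.mk_ker, hP']
          infer_instance
        have hPmax : P.IsMaximal := (Ideal.bot_quotient_isMaximal_iff P).mp hmax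
        exact (hPmax.eq_of_le (Ideal.IsPrime.ne_top (Ideal.comap_isPrime _ _)) hP𝔐).ge
    have hass := Module.associatedPrimes.minimalPrimes_annihilator_subset_associatedPrimes
      (MvPolynomial σ V) (MvPolynomial σ V ⧸ K) h𝔐min
    obtain ⟨-, q, hq⟩ := isAssociatedPrime_iff.mp hass
    obtain ⟨h, rfl⟩ := Ideal.Quotient.mk_surjective q
    have hmem : ∀ u, u ∈ 𝔐 ↔ u * h * x ∈ 𝔞 := fun u => by
      rw [hq, Submodule.mem_colon_singleton, Submodule.mem_bot, ← hK,
        ← Ideal.Quotient.eq_zero_iff_mem, map_mul]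
      rfl
    refine ⟨h, fun hcon => ?_, fun j => ?_⟩
    · have h1 : (1 : MvPolynomial σ V) ∈ 𝔐 := (hmem 1).mpr (by rwa [one_mul])
      exact (Ideal.IsPrime.ne_top (Ideal.comap_isPrime _ _)) ((Ideal.eq_top_iff_one _).mpr h1)
    · rw [← mul_assoc]
      exact (hmem _).mp (hX𝔐 j)
  obtain ⟨v, w, hw⟩ := exists_sub_smul_det_sub_mul_mem hf hM rfl hlead
    (mem_nonZeroDivisors_of_ne_zero hτ.ne_zero) p hreg (h * x) fun j => (h𝔞_mem _).mp (hhx j)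
  -- Otherwise `τ` divides `v`. But `τ ≡ y` modulo `f₀` and `y ∈ (X)` kills the determinant, so `h *
  -- x` would lie in `𝔞`.
  have hv : IsUnit v := by
    by_contra hv
    obtain ⟨v', rfl⟩ : τ ∣ v := by
      rw [← Ideal.mem_span_singleton, ← hτ.maximalIdeal_eq]
      exact (IsLocalRing.mem_maximalIdeal _).mpr hv
    refine hh ((h𝔞_mem _).mpr ⟨w + v' • A'.det, ?_⟩)
    have h1 : y * A'.det ∈ 𝔉 := by
      rw [hy, Finset.sum_mul]
      refine sum_mem fun i _ => ?_
      rw [mul_assoc]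
      exact Ideal.mul_mem_left _ _ (det_mul_X_mem rfl i)
    have h2 := add_mem hw (Ideal.mul_mem_left _ (C v') h1)
    convert h2 using 1
    simp only [smul_eq_C_mul, hf₀, map_mul]
    ring
  have h1 := hφ𝔉 _ hw
  rw [map_sub, map_sub, map_mul, map_mul, hφf₀, zero_mul, sub_zero, smul_eq_C_mul, map_mul,
    hφC, hφdet, sub_eq_zero] at h1
  have h2 : φ₀ v * A.det ∈ IsLocalRing.maximalIdeal R ^ N := h1 ▸ Ideal.mul_mem_left _ _ hr
  exact (Ideal.unit_mul_mem_iff_mem _ (hv.map φ₀)).mp h2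

end Presentation

end PurePower

end

section

open Polynomial

universe u

namespace CohenRing

/-! ### Maximal unramified subrings of a characteristic zero cover of a field. -/

section Zorn

variable {O k : Type*} [CommRing O] [Field k] (ρ : O →+* k) (p : ℕ)

/-- Every element of `W` in the kernel of `ρ` is a multiple of `p` in `W`. -/
def IsUnramified (W : Subring O) : Prop :=
  ∀ w ∈ W, ρ w = 0 → ∃ w' ∈ W, w = p * w'

variable {ρ p} {W : Subring O}

/-- Zorn's lemma, starting from the image of the integers: an integer that vanishes in `k` is a
multiple of `p`. -/
theorem exists_maximal_isUnramified [CharP k p] :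
    ∃ W : Subring O, Maximal (IsUnramified ρ p) W := by
  obtain ⟨W, -, hW⟩ := zorn_le_nonempty₀ {W : Subring O | IsUnramified ρ p W} (fun c hc hch y hy => by
    refine ⟨sSup c, ?_, fun z hz => le_sSup hz⟩
    intro w hw h0
    rw [Subring.mem_sSup_of_directedOn ⟨y, hy⟩ hch.directedOn] at hw
    obtain ⟨s, hs, hws⟩ := hw
    obtain ⟨w', hw', rfl⟩ := hc hs w hws h0
    exact ⟨w', (le_sSup hs) hw', rfl⟩) ⊥ (by
    intro w hw h0
    obtain ⟨n, rfl⟩ := Subring.mem_bot.mp hw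
    rw [map_intCast, CharP.intCast_eq_zero_iff k p] at h0
    obtain ⟨m, rfl⟩ := h0
    exact ⟨m, Subring.mem_bot.mpr ⟨m, rfl⟩, by push_cast; rfl⟩)
  exact ⟨W, hW⟩

/-- Inverting the elements of nonzero residue keeps a subring unramified, so a maximal one already
contains these inverses. -/
theorem exists_mul_eq_one (hW : Maximal (IsUnramified ρ p) W)
    (hunit : ∀ x, ρ x ≠ 0 → IsUnit x) {w : O} (hw : w ∈ W) (h0 : ρ w ≠ 0) :
    ∃ w' ∈ W, w * w' = 1 := by
  let W' : Subring O :=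
    { carrier := {x | ∃ s ∈ W, ρ s ≠ 0 ∧ s * x ∈ W}
      zero_mem' := ⟨1, W.one_mem, by simp, by simp⟩
      one_mem' := ⟨1, W.one_mem, by simp, by simp⟩
      add_mem' := by
        rintro x y ⟨s, hs, hs0, hx⟩ ⟨t, ht, ht0, hy⟩
        refine ⟨s * t, W.mul_mem hs ht, by rw [map_mul]; exact mul_ne_zero hs0 ht0, ?_⟩
        have : s * t * (x + y) = t * (s * x) + s * (t * y) := by ring
        rw [this]
        exact W.add_mem (W.mul_mem ht hx) (W.mul_mem hs hy)
      mul_mem' := by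
        rintro x y ⟨s, hs, hs0, hx⟩ ⟨t, ht, ht0, hy⟩
        refine ⟨s * t, W.mul_mem hs ht, by rw [map_mul]; exact mul_ne_zero hs0 ht0, ?_⟩
        have : s * t * (x * y) = (s * x) * (t * y) := by ring
        rw [this]
        exact W.mul_mem hx hy
      neg_mem' := by
        rintro x ⟨s, hs, hs0, hx⟩
        exact ⟨s, hs, hs0, by rw [mul_neg]; exact W.neg_mem hx⟩ }
  have hle : W ≤ W' := fun x hx => ⟨1, W.one_mem, by simp, by simpa using hx⟩
  have hW' : IsUnramified ρ p W' := by
    rintro x ⟨s, hs, hs0, hx⟩ hx0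
    obtain ⟨y, hy, hxy⟩ := hW.prop _ hx (by rw [map_mul, hx0, mul_zero])
    obtain ⟨t, ht⟩ := hunit s hs0
    refine ⟨(↑t⁻¹ : O) * y, ⟨s, hs, hs0, by rwa [← ht, Units.mul_inv_cancel_left]⟩, ?_⟩
    rw [mul_left_comm, ← hxy, ← ht, Units.inv_mul_cancel_left]
  obtain ⟨t, ht⟩ := hunit w h0
  refine ⟨(↑t⁻¹ : O), hW.2 hW' hle ⟨w, hw, h0, ?_⟩, ?_⟩ <;>
  rw [← ht, Units.mul_inv]
  exact W.one_mem

theorem exists_monic_of_map_ne_zero (hW : Maximal (IsUnramified ρ p) W)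
    (hunit : ∀ x, ρ x ≠ 0 → IsUnit x) {g : W[X]} (hg : g.map (ρ.comp W.subtype) ≠ 0) {a : k}
    (ha : g.eval₂ (ρ.comp W.subtype) a = 0) :
    ∃ h : W[X], h.Monic ∧ h.eval₂ (ρ.comp W.subtype) a = 0 ∧ h.natDegree ≤ g.natDegree := by
  set r := ρ.comp W.subtype
  have hlc : r (g.coeff (g.map r).natDegree) ≠ 0 := by
    rw [← coeff_map]; exact leadingCoeff_ne_zero.mpr hg
  obtain ⟨u, hu, hu1⟩ := exists_mul_eq_one hW hunit (g.coeff (g.map r).natDegree).2 hlc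
  have hru : r ⟨u, hu⟩ * (g.map r).leadingCoeff = 1 := by
    rw [leadingCoeff, coeff_map, ← map_mul, ← map_one r]
    congr 1
    rw [mul_comm]
    exact Subtype.ext hu1
  have hmonic : ((C (⟨u, hu⟩ : W) * g).map r).Monic := by
    rw [Polynomial.map_mul, map_C, Monic, leadingCoeff_mul, leadingCoeff_C, hru]
  obtain ⟨h, h1, h2, h3⟩ := lifts_and_natDegree_eq_and_monic
    (f := r) (p := (C (⟨u, hu⟩ : W) * g).map r) ⟨_, rfl⟩ hmonic
  refine ⟨h, h3, ?_, ?_⟩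
  · rw [← eval_map, h1, Polynomial.map_mul, eval_mul, eval_map (f := r) (p := g), ha, mul_zero]
  · rw [h2]
    exact natDegree_map_le.trans (natDegree_C_mul_le _ _)

theorem surjective_of_maximal (hW : Maximal (IsUnramified ρ p) W)
    (hunit : ∀ x, ρ x ≠ 0 → IsUnit x) (hsurj : Function.Surjective ρ)
    (hroot : ∀ h : O[X], h.Monic → ∀ a, h.eval₂ ρ a = 0 → ∃ θ, h.eval θ = 0 ∧ ρ θ = a) (a : k) :
    ∃ w ∈ W, ρ w = a := by
  classical
  by_contra! hcon
  set r := ρ.comp W.subtype with hr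
  -- Adjoining such a `θ` keeps the subring unramified: if `g'(θ)` has residue zero, all
  -- coefficients of `g'` do too, so `p` divides `g'`. Maximality then forces `θ ∈ W`.
  suffices H : ∃ θ : O, ρ θ = a ∧ ∀ g : W[X], ∃ g' : W[X],
      g'.eval₂ W.subtype θ = g.eval₂ W.subtype θ ∧ (g'.eval₂ r a = 0 → g'.map r = 0) by
    obtain ⟨θ, hθ, H⟩ := H
    let W' : Subring O := (eval₂RingHom W.subtype θ).range
    have hle : W ≤ W' := fun w hw => ⟨C ⟨w, hw⟩, by simp⟩
    have hW' : IsUnramified ρ p W' := by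
      rintro _ ⟨g, rfl⟩ h0
      obtain ⟨g', h1, h2⟩ := H g
      rw [coe_eval₂RingHom, ← h1, hom_eval₂, hθ] at h0
      have h3 : C (p : W) ∣ g' := by
        rw [C_dvd_iff_dvd_coeff]
        intro i
        have h4 : r (g'.coeff i) = 0 := by rw [← coeff_map, h2 h0, coeff_zero]
        obtain ⟨w', hw', h5⟩ := hW.prop _ (g'.coeff i).2 h4
        exact ⟨⟨w', hw'⟩, Subtype.ext (by rw [h5]; simp)⟩
      obtain ⟨g'', rfl⟩ := h3
      refine ⟨_, ⟨g'', rfl⟩, ?_⟩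
      rw [coe_eval₂RingHom, ← h1, eval₂_mul, eval₂_C]
      simp
    exact hcon θ (hW.2 hW' hle ⟨X, by simp⟩) hθ
  by_cases hex : ∃ g : W[X], g.map r ≠ 0 ∧ g.eval₂ r a = 0
  · obtain ⟨g, hg, hga⟩ := hex
    -- In the algebraic case, `θ` is a root of a monic `h` of least degree with `a` as a residual
    -- root; remainders modulo `h` serve as `g'`. In the transcendental case any lift of `a` works.
    have hex' : ∃ n, ∃ h : W[X], h.Monic ∧ h.eval₂ r a = 0 ∧ h.natDegree = n := by
      obtain ⟨h, h1, h2, -⟩ := exists_monic_of_map_ne_zero hW hunit hg hga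
      exact ⟨_, h, h1, h2, rfl⟩
    obtain ⟨h, h1, h2, h3⟩ := Nat.find_spec hex'
    obtain ⟨θ, hθ, hθa⟩ := hroot (h.map W.subtype) (h1.map _) a (by rw [eval₂_map]; exact h2)
    refine ⟨θ, hθa, fun g => ⟨g %ₘ h, ?_, fun h4 => ?_⟩⟩
    · conv_rhs => rw [← modByMonic_add_div g h]
      rw [eval₂_add, eval₂_mul, ← eval_map (p := h), hθ, zero_mul, add_zero]
    · by_contra h5
      obtain ⟨h', h6, h7, h8⟩ := exists_monic_of_map_ne_zero hW hunit h5 h4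
      have h9 : h ≠ 1 := by
        rintro rfl
        simp at h2
      have h10 := natDegree_modByMonic_lt g h1 h9
      exact Nat.find_min hex' (m := h'.natDegree) (by lia) ⟨h', h6, h7, rfl⟩
  · push Not at hex
    obtain ⟨θ, hθ⟩ := hsurj a
    refine ⟨θ, hθ, fun g => ⟨g, rfl, fun h => ?_⟩⟩
    by_contra h'
    exact hex g h' h

end Zorn

/-! ### From a local domain with principal maximal ideal to a discrete valuation ring. -/

section Quotient

variable {W : Type*} [CommRing W] {π : W}

/-- Divide by `π` as often as possible. `W` need not be Noetherian, so the intersection of the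
powers may be nonzero and has to be divided out. -/
theorem exists_eq_pow_mul_isUnit (hdvd : ∀ x, ¬ IsUnit x → π ∣ x) {x : W}
    (hx : x ∉ ⨅ n : ℕ, Ideal.span {π ^ n}) : ∃ (n : ℕ) (u : W), IsUnit u ∧ x = π ^ n * u := by
  classical
  have hex : ∃ n, ¬ π ^ n ∣ x := by
    by_contra! h
    exact hx ((Ideal.mem_iInf).mpr fun n => Ideal.mem_span_singleton.mpr (h n))
  obtain ⟨n, hn⟩ : ∃ n, Nat.find hex = n + 1 :=
    Nat.exists_eq_succ_of_ne_zero fun h => by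
      have := Nat.find_spec hex
      rw [h, pow_zero] at this
      exact this (one_dvd x)
  obtain ⟨u, hu⟩ := not_not.mp (Nat.find_min hex (m := n) (by lia))
  refine ⟨n, u, ?_, hu⟩
  by_contra hc
  obtain ⟨v, rfl⟩ := hdvd u hc
  have h1 := Nat.find_spec hex
  rw [hn] at h1
  exact h1 ⟨v, by rw [hu, pow_succ, mul_assoc]⟩

variable [IsDomain W]

theorem pow_mul_notMem (h0 : π ≠ 0) (hπ : ¬ IsUnit π) (n : ℕ) {u : W} (hu : IsUnit u) :
    π ^ n * u ∉ Ideal.span {π ^ (n + 1)} := by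
  intro h
  obtain ⟨c, hc⟩ := Ideal.mem_span_singleton.mp h
  rw [pow_succ, mul_assoc] at hc
  have := mul_left_cancel₀ (pow_ne_zero n h0) hc
  exact hπ (isUnit_of_mul_isUnit_left (this ▸ hu))

theorem isPrime_iInf_span_pow (hdvd : ∀ x, ¬ IsUnit x → π ∣ x) (h0 : π ≠ 0) (hπ : ¬ IsUnit π) :
    (⨅ n : ℕ, Ideal.span {π ^ n}).IsPrime := by
  refine ⟨fun h => ?_, fun {x y} hxy => ?_⟩
  · have h1 := (Ideal.eq_top_iff_one _).mp h
    exact pow_mul_notMem h0 hπ 0 isUnit_one (by simpa using (Ideal.mem_iInf.mp h1 1))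
  · by_contra! hc
    obtain ⟨n, u, hu, rfl⟩ := exists_eq_pow_mul_isUnit hdvd hc.1
    obtain ⟨m, v, hv, rfl⟩ := exists_eq_pow_mul_isUnit hdvd hc.2
    refine pow_mul_notMem h0 hπ (n + m) (hu.mul hv) ?_
    have := Ideal.mem_iInf.mp hxy (n + m + 1)
    convert this using 1
    ring

/-- A local domain with principal maximal ideal `(π)` becomes a discrete valuation ring after
dividing out `⨅ (π ^ n)`. -/
theorem irreducible_and_hasUnitMulPow (hdvd : ∀ x, ¬ IsUnit x → π ∣ x) (h0 : π ≠ 0)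
    (hπ : ¬ IsUnit π) :
    Irreducible (Ideal.Quotient.mk (⨅ n : ℕ, Ideal.span {π ^ n}) π) ∧
    ∀ {x : W ⧸ ⨅ n : ℕ, Ideal.span {π ^ n}}, x ≠ 0 →
      ∃ n : ℕ, Associated (Ideal.Quotient.mk (⨅ n : ℕ, Ideal.span {π ^ n}) π ^ n) x := by
  set J : Ideal W := ⨅ n : ℕ, Ideal.span {π ^ n} with hJ
  have key : ∀ x : W ⧸ J, x ≠ 0 → ∃ (n : ℕ) (u : W), IsUnit u ∧
      x = Ideal.Quotient.mk J π ^ n * Ideal.Quotient.mk J u := by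
    intro x hx
    obtain ⟨x, rfl⟩ := Ideal.Quotient.mk_surjective x
    obtain ⟨n, u, hu, rfl⟩ := exists_eq_pow_mul_isUnit (x := x) hdvd fun h =>
      hx (Ideal.Quotient.eq_zero_iff_mem.mpr h)
    exact ⟨n, u, hu, by rw [map_mul, map_pow]⟩
  have hmem : ∀ (n : ℕ) {u : W}, IsUnit u → ∀ c, Ideal.Quotient.mk J (π ^ n * u) ≠
      Ideal.Quotient.mk J (π ^ (n + 1) * c) := by
    intro n u hu c h
    have h1 := Ideal.mem_iInf.mp (Ideal.Quotient.eq.mp h) (n + 1)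
    have h2 := add_mem h1 (Ideal.mul_mem_right c _ (Ideal.mem_span_singleton_self (π ^ (n + 1))))
    rw [sub_add_cancel] at h2
    exact pow_mul_notMem h0 hπ n hu h2
  refine ⟨⟨fun h => ?_, fun {a b} hab => ?_⟩, fun {x} hx => ?_⟩
  · obtain ⟨c, hc⟩ := h.exists_right_inv
    obtain ⟨c, rfl⟩ := Ideal.Quotient.mk_surjective c
    refine hmem 0 isUnit_one c ?_
    rw [pow_zero, one_mul, zero_add, pow_one, map_mul, hc, map_one]
  · have hne : Ideal.Quotient.mk J π ≠ 0 := fun h => by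
      refine hmem 1 isUnit_one 0 ?_
      rw [pow_one, mul_one, mul_zero, map_zero, h]
    obtain ⟨n, u, hu, rfl⟩ := key a (by rintro rfl; simp [hne] at hab)
    obtain ⟨m, v, hv, rfl⟩ := key b (by rintro rfl; simp [hne] at hab)
    rcases n with _ | n
    · left; simpa using hu.map (Ideal.Quotient.mk J)
    rcases m with _ | m
    · right; simpa using hv.map (Ideal.Quotient.mk J)
    exfalso
    refine hmem 1 isUnit_one (π ^ (n + m) * u * v) ?_
    rw [pow_one, mul_one, hab]
    simp only [map_mul, map_pow]
    ring
  · obtain ⟨n, u, hu, rfl⟩ := key x hx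
    obtain ⟨u', hu'⟩ := hu.map (Ideal.Quotient.mk J)
    exact ⟨n, u', by rw [hu']⟩

end Quotient

/-! ### A cover of the residue field over which roots lift. -/

section Ambient

variable {Ω : Type*} [Field Ω] [IsAlgClosed Ω]

/-- A valuation ring of an algebraically closed field is integrally closed, so monic polynomials
split over it. Dividing off linear factors, one of them must reduce to the given residual root. -/
theorem exists_root_of_residue_root (B : ValuationSubring Ω) (n : ℕ) :
    ∀ h : B[X], h.natDegree = n → h.Monic → ∀ b, h.eval₂ (IsLocalRing.residue B) b = 0 →
      ∃ θ, h.eval θ = 0 ∧ IsLocalRing.residue B θ = b := by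
  induction n with
  | zero =>
    intro h hn hm b hb
    rw [hm.natDegree_eq_zero.mp hn] at hb
    simp at hb
  | succ n ih =>
    intro h hn hm b hb
    have hdeg : (h.map (algebraMap B Ω)).degree ≠ 0 := by
      rw [hm.degree_map, degree_eq_natDegree hm.ne_zero, hn]
      exact_mod_cast Nat.succ_ne_zero n
    obtain ⟨x, hx⟩ := IsAlgClosed.exists_root _ hdeg
    have hint : IsIntegral B x := ⟨h, hm, by rwa [IsRoot, eval_map] at hx⟩
    obtain ⟨θ, rfl⟩ := IsIntegrallyClosed.isIntegral_iff.mp hint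
    have hθ : h.eval θ = 0 := by
      rw [IsRoot, eval_map, eval₂_at_apply] at hx
      exact (FaithfulSMul.algebraMap_injective B Ω) (by rw [hx, map_zero])
    have hfac := mul_divByMonic_eq_iff_isRoot.mpr hθ
    by_cases hb' : IsLocalRing.residue B θ = b
    · exact ⟨θ, hθ, hb'⟩
    · rw [← hfac, eval₂_mul, mul_eq_zero] at hb
      have h1 : (h /ₘ (X - C θ)).eval₂ (IsLocalRing.residue B) b = 0 := by
        refine hb.resolve_left fun h0 => hb' ?_
        rw [eval₂_sub, eval₂_X, eval₂_C, sub_eq_zero] at h0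
        exact h0.symm
      have h2 : (h /ₘ (X - C θ)).Monic := by
        rw [← hfac] at hm
        exact (monic_X_sub_C θ).of_mul_monic_left hm
      obtain ⟨η, hη, hηb⟩ := ih _ (by rw [natDegree_divByMonic _ (monic_X_sub_C θ), hn]; simp) h2 b h1
      refine ⟨η, ?_, hηb⟩
      rw [← hfac, eval_mul, hη, mul_zero]

end Ambient

/-- A characteristic zero local domain with residue field `k` over which roots lift. -/
theorem exists_ambient {k : Type u} [Field k] (p : ℕ) [hp : Fact p.Prime] [CharP k p] :
    ∃ (O : Type u) (_ : CommRing O) (_ : IsDomain O) (ρ : O →+* k), Function.Surjective ρ ∧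
      (∀ x, ρ x ≠ 0 → IsUnit x) ∧ (p : O) ≠ 0 ∧
      ∀ h : O[X], h.Monic → ∀ a, h.eval₂ ρ a = 0 → ∃ θ, h.eval θ = 0 ∧ ρ θ = a := by
  have hloc : IsLocalHom (WittVector.constantCoeff : WittVector p k →+* k) :=
    ⟨fun x hx => WittVector.isUnit_of_coeff_zero_ne_zero x hx.ne_zero⟩
  have : IsLocalRing (WittVector p k) :=
    RingHom.domain_isLocalRing (WittVector.constantCoeff : WittVector p k →+* k)
  let Ω := AlgebraicClosure (FractionRing (WittVector p k))
  let f : WittVector p k →+* Ω :=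
    (algebraMap (FractionRing (WittVector p k)) Ω).comp (algebraMap _ _)
  have hf : Function.Injective f :=
    (algebraMap (FractionRing (WittVector p k)) Ω).injective.comp
      (IsFractionRing.injective (WittVector p k) (FractionRing (WittVector p k)))
  obtain ⟨B, hB, hBloc⟩ := IsLocalRing.exists_factor_valuationRing f
  let f' : WittVector p k →+* B := f.codRestrict B.toSubring hB
  have hBloc' : IsLocalHom f' := hBloc
  have hcsurj : Function.Surjective (WittVector.constantCoeff : WittVector p k →+* k) := fun a =>
    ⟨WittVector.teichmuller p a, WittVector.teichmuller_coeff_zero p a⟩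
  have hker : RingHom.ker (WittVector.constantCoeff : WittVector p k →+* k) ≤
      RingHom.ker ((IsLocalRing.residue B).comp f') := fun w hw => by
    rw [RingHom.mem_ker, RingHom.comp_apply, IsLocalRing.residue_eq_zero_iff,
      IsLocalRing.mem_maximalIdeal]
    intro hu
    have h1 := (isUnit_of_map_unit f' w hu).map (WittVector.constantCoeff : WittVector p k →+* k)
    rw [RingHom.mem_ker.mp hw] at h1
    exact not_isUnit_zero h1
  let ι : k →+* IsLocalRing.ResidueField B :=
    RingHom.liftOfSurjective (WittVector.constantCoeff : WittVector p k →+* k) hcsurj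
      ⟨(IsLocalRing.residue B).comp f', hker⟩
  have hι : ∀ w, ι (WittVector.constantCoeff w) = IsLocalRing.residue B (f' w) := fun w =>
    RingHom.liftOfRightInverse_comp_apply _ _ _ ⟨(IsLocalRing.residue B).comp f', hker⟩ w
  -- The residue field of `B` may be larger than `k`; `O` is the preimage of `k` in `B`. It still
  -- contains every root in `B` whose residue lies in `k`.
  let O : Subring B := ι.range.comap (IsLocalRing.residue B)
  let e : k ≃+* ι.range := RingEquiv.ofBijective ι.rangeRestrict
    ⟨fun a b hab => ι.injective (congrArg Subtype.val hab), ι.rangeRestrict_surjective⟩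
  let ρ : O →+* k := (e.symm : ι.range →+* k).comp
    (((IsLocalRing.residue B).comp O.subtype).codRestrict ι.range fun x => x.2)
  have hρ : ∀ x a, ρ x = a ↔ IsLocalRing.residue B x = ι a := fun x a => by
    change e.symm ⟨IsLocalRing.residue B x, x.2⟩ = a ↔ _
    rw [RingEquiv.symm_apply_eq]
    exact Subtype.ext_iff
  refine ⟨O, inferInstance, inferInstance, ρ, fun a => ?_, fun x hx => ?_, fun h0 => ?_,
    fun h hm a ha => ?_⟩
  · obtain ⟨w, rfl⟩ := hcsurj a
    exact ⟨⟨f' w, _, hι w⟩, (hρ _ _).mpr (hι w).symm⟩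
  · have hx0 : IsLocalRing.residue B (x : B) ≠ 0 := fun h => hx ((hρ x 0).mpr (by rw [h, map_zero]))
    obtain ⟨u, hu⟩ : IsUnit (x : B) := by
      by_contra h
      exact hx0 ((IsLocalRing.residue_eq_zero_iff _).mpr ((IsLocalRing.mem_maximalIdeal _).mpr h))
    have hxa := (hρ x _).mp rfl
    have hinv : (↑u⁻¹ : B) ∈ O := by
      refine ⟨(ρ x)⁻¹, ?_⟩
      rw [map_inv₀, ← hxa, ← hu]
      refine inv_eq_of_mul_eq_one_right ?_
      rw [← map_mul, Units.mul_inv, map_one]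
    exact IsUnit.of_mul_eq_one ⟨_, hinv⟩ (Subtype.ext (by simp [← hu]))
  · have h1 : f' (p : WittVector p k) = 0 := by
      rw [map_natCast]; exact congrArg Subtype.val h0
    have h2 : f (p : WittVector p k) = 0 := congrArg Subtype.val h1
    exact WittVector.p_nonzero p k (hf (by rw [h2, map_zero]))
  · have hcomp : (IsLocalRing.residue B).comp O.subtype = ι.comp ρ :=
      RingHom.ext fun x => (hρ x _).mp rfl
    have h1 : (h.map O.subtype).eval₂ (IsLocalRing.residue B) (ι a) = 0 := by
      rw [eval₂_map, hcomp, ← hom_eval₂, ha, map_zero]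
    obtain ⟨θ, hθ, hθa⟩ := exists_root_of_residue_root B _ _ rfl (hm.map _) _ h1
    refine ⟨⟨θ, a, hθa.symm⟩, ?_, (hρ _ _).mpr hθa⟩
    refine Subtype.val_injective ?_
    have h2 : (h.map O.subtype).eval (O.subtype ⟨θ, a, hθa.symm⟩) = 0 := hθ
    rw [eval_map, eval₂_at_apply] at h2
    exact h2

/-- Every field of characteristic `p` is the residue field of a discrete valuation ring with
uniformizer `p`. -/
theorem exists_discreteValuationRing {k : Type u} [Field k] (p : ℕ) [hp : Fact p.Prime]
    [CharP k p] :
    ∃ (V : Type u) (_ : CommRing V) (_ : IsDomain V) (_ : IsDiscreteValuationRing V) (ρ : V →+* k),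
      Function.Surjective ρ ∧ (p : V) ≠ 0 ∧ ∀ v, ρ v = 0 → (p : V) ∣ v := by
  obtain ⟨O, _, _, ρ, hsurj, hunit, hp0, hroot⟩ := exists_ambient (k := k) p
  obtain ⟨W, hW⟩ := exists_maximal_isUnramified (ρ := ρ) (p := p)
  have hpk : ρ p = 0 := by rw [map_natCast, CharP.cast_eq_zero]
  have hker : ∀ w : W, ρ w = 0 → (p : W) ∣ w := fun w hw => by
    obtain ⟨w', hw', h⟩ := hW.prop w w.2 hw
    exact ⟨⟨w', hw'⟩, Subtype.ext (by rw [h]; simp)⟩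
  have hdvd : ∀ w : W, ¬ IsUnit w → (p : W) ∣ w := fun w hw => by
    refine hker w ?_
    by_contra h0
    obtain ⟨w', hw', h⟩ := exists_mul_eq_one hW hunit w.2 h0
    exact hw (IsUnit.of_mul_eq_one ⟨w', hw'⟩ (Subtype.ext h))
  have hp0' : (p : W) ≠ 0 := fun h => hp0 (by simpa using congrArg Subtype.val h)
  have hpu : ¬ IsUnit (p : W) := fun h => by
    have := h.map (ρ.comp W.subtype)
    rw [map_natCast, CharP.cast_eq_zero] at this
    exact not_isUnit_zero this
  obtain ⟨h1, h2⟩ := irreducible_and_hasUnitMulPow hdvd hp0' hpu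
  have hprime := isPrime_iInf_span_pow hdvd hp0' hpu
  have hdom : IsDomain (W ⧸ ⨅ n : ℕ, Ideal.span {(p : W) ^ n}) := Ideal.Quotient.isDomain _
  have hJ : ∀ w ∈ (⨅ n : ℕ, Ideal.span {(p : W) ^ n}), (ρ.comp W.subtype) w = 0 := fun w hw => by
    obtain ⟨c, rfl⟩ := Ideal.mem_span_singleton.mp (Ideal.mem_iInf.mp hw 1)
    rw [pow_one, map_mul, map_natCast, CharP.cast_eq_zero, zero_mul]
  refine ⟨W ⧸ ⨅ n : ℕ, Ideal.span {(p : W) ^ n}, inferInstance, hdom,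
    IsDiscreteValuationRing.ofHasUnitMulPowIrreducibleFactorization ⟨_, h1, h2⟩,
    Ideal.Quotient.lift _ (ρ.comp W.subtype) hJ, fun a => ?_, fun h => ?_, fun v hv => ?_⟩
  · obtain ⟨w, hw, rfl⟩ := surjective_of_maximal hW hunit hsurj hroot a
    exact ⟨Ideal.Quotient.mk _ ⟨w, hw⟩, by rw [Ideal.Quotient.lift_mk]; rfl⟩
  · exact h1.ne_zero (by rw [map_natCast]; exact h)
  · obtain ⟨w, rfl⟩ := Ideal.Quotient.mk_surjective v
    rw [Ideal.Quotient.lift_mk] at hv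
    obtain ⟨c, hc⟩ := hker w hv
    exact ⟨Ideal.Quotient.mk _ c, by rw [hc, map_mul, map_natCast]⟩

end CohenRing

end

section

open Polynomial

universe u

namespace CohenRing

/-! ### Splitting square-zero extensions of fields in characteristic `p`. -/

section Section

variable {E k : Type*} [CommRing E] [Field k]

theorem pow_eq_pow_of_map_eq {p : ℕ} [hp : Fact p.Prime] [CharP E p] {q : E →+* k} (hsq : ∀ x y, q x = 0 → q y = 0 → x * y = 0) {x y : E}
    (h : q x = q y) : x ^ p = y ^ p := by
  have h1 : (x - y) ^ p = 0 := by
    have h2 : q (x - y) = 0 := by rw [map_sub, h, sub_self]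
    obtain ⟨n, hn⟩ := Nat.exists_eq_add_of_le hp.out.two_le
    rw [hn, pow_add, pow_two, hsq _ _ h2 h2, zero_mul]
  rw [sub_pow_char, sub_eq_zero] at h1
  exact h1

/-- A square-zero extension of a field of characteristic `p` by a ring of characteristic `p`
splits. -/
theorem exists_section (p : ℕ) [hp : Fact p.Prime] [CharP E p] {q : E →+* k} (hq : Function.Surjective q)
    (hsq : ∀ x y, q x = 0 → q y = 0 → x * y = 0) : ∃ s : k →+* E, q.comp s = RingHom.id k := by
  classical
  -- Since a `p`-th power depends only on the residue, the subring of `p`-th powers meets the kernel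
  -- trivially. Requiring it inside `F` makes the image of `F` a field over which `k` is purely
  -- inseparable.
  let P : Set (Subring E) := {F | (∀ x, x ^ p ∈ F) ∧ ∀ x ∈ F, q x = 0 → x = 0}
  obtain ⟨F, -, hF⟩ := zorn_le_nonempty₀ P (fun c hc hch y hy => by
    refine ⟨sSup c, ⟨fun x => le_sSup hy ((hc hy).1 x), ?_⟩, fun z hz => le_sSup hz⟩
    intro w hw h0
    rw [Subring.mem_sSup_of_directedOn ⟨y, hy⟩ hch.directedOn] at hw
    obtain ⟨s, hs, hws⟩ := hw
    exact (hc hs).2 w hws h0) (frobenius E p).range (by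
    refine ⟨fun x => ⟨x, rfl⟩, ?_⟩
    rintro _ ⟨x, rfl⟩ h0
    rw [frobenius_def, map_pow] at h0
    have h1 : q x = q 0 := by rw [map_zero]; exact pow_eq_zero_iff hp.out.ne_zero |>.mp h0
    rw [frobenius_def, pow_eq_pow_of_map_eq hsq h1, zero_pow hp.out.ne_zero])
  have hinj : Function.Injective (q.comp F.subtype) := by
    rw [injective_iff_map_eq_zero]
    exact fun x hx => Subtype.ext (hF.prop.2 x x.2 hx)
  have hsurj : Function.Surjective (q.comp F.subtype) := by
    by_contra hns
    have hcon : ∃ a, ∀ x ∈ F, q x ≠ a := by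
      by_contra! h
      exact hns fun a => (h a).elim fun x hx => ⟨⟨x, hx.1⟩, hx.2⟩
    obtain ⟨a, ha⟩ := hcon
    obtain ⟨b, rfl⟩ := hq a
    let K : Subfield k :=
      { (q.comp F.subtype).range with
        inv_mem' := by
          rintro _ ⟨x, rfl⟩
          by_cases hx : (q.comp F.subtype) x = 0
          · rw [hx, inv_zero]; exact ⟨0, map_zero _⟩
          obtain ⟨y, hy⟩ := hq ((q.comp F.subtype) x)⁻¹
          refine ⟨x ^ (p - 1) * ⟨y ^ p, hF.prop.1 y⟩, ?_⟩
          rw [map_mul, map_pow]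
          change _ * q (y ^ p) = _
          rw [map_pow, hy, inv_pow, ← Nat.sub_add_cancel hp.out.one_le, pow_succ]
          field_simp
          simp }
    have hK : ∀ x, x ∈ K ↔ ∃ y : F, q y = x := fun x => Iff.rfl
    let r : F →+* K := (q.comp F.subtype).codRestrict K.toSubring fun x => ⟨x, rfl⟩
    have hr : Function.Injective r := fun x y h => hinj (congrArg Subtype.val h)
    let h : F[X] := X ^ p - C ⟨b ^ p, hF.prop.1 b⟩
    -- Frobenius is injective on `k`, so a `p`-th root of `q b ^ p` in `K` would be `q b` itself,
    -- which is not in the image of `F`. Thus adjoining `b` creates no kernel, against maximality.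
    have hirr : Irreducible (h.map r) := by
      have h1 : h.map r = X ^ p - C (r ⟨b ^ p, hF.prop.1 b⟩) := by simp [h]
      rw [h1]
      have : CharP k p := charP_of_injective_ringHom (f := q.comp F.subtype) hinj p
      refine X_pow_sub_C_irreducible_of_prime hp.out fun y hy => ?_
      have h2 : (y : k) ^ p = q b ^ p := by
        rw [← map_pow]; exact congrArg Subtype.val hy
      obtain ⟨z, hz⟩ := y.2
      exact ha z z.2 (hz.trans (frobenius_inj k p h2))
    have hmon : h.Monic := monic_X_pow_sub_C _ hp.out.ne_zero
    have hmin : h.map r = minpoly K (q b) := by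
      refine minpoly.eq_of_irreducible_of_monic hirr ?_ (hmon.map _)
      rw [aeval_def, eval₂_map]
      rw [eval₂_sub, eval₂_pow, eval₂_X, eval₂_C, sub_eq_zero, ← map_pow]
      rfl
    let F' : Subring E := (eval₂RingHom F.subtype b).range
    have hle : F ≤ F' := fun w hw => ⟨C ⟨w, hw⟩, by simp⟩
    have hF' : F' ∈ P := by
      refine ⟨fun x => hle (hF.prop.1 x), ?_⟩
      rintro _ ⟨g, rfl⟩ h0
      have hb : h.eval₂ F.subtype b = 0 := by simp [h, eval₂_sub]
      have h1 : (eval₂RingHom F.subtype b) g = (g %ₘ h).eval₂ F.subtype b := by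
        conv_lhs => rw [← modByMonic_add_div g h]
        rw [coe_eval₂RingHom, eval₂_add, eval₂_mul, hb, zero_mul, add_zero]
      rw [h1] at h0 ⊢
      suffices h2 : g %ₘ h = 0 by rw [h2, eval₂_zero]
      by_contra h2
      rw [hom_eval₂] at h0
      have h3 : minpoly K (q b) ∣ (g %ₘ h).map r := by
        refine minpoly.dvd _ _ ?_
        rw [aeval_def, eval₂_map]
        exact h0
      have h4 := natDegree_le_of_dvd h3 ((Polynomial.map_ne_zero_iff hr).mpr h2)
      rw [← hmin, hmon.natDegree_map, natDegree_map_eq_of_injective hr] at h4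
      have h5 : h ≠ 1 := by
        rintro h5
        rw [h5, Polynomial.map_one] at hirr
        exact hirr.not_isUnit isUnit_one
      exact absurd (natDegree_modByMonic_lt g hmon h5) (not_lt.mpr h4)
    exact ha b (hF.2 hF' hle ⟨X, by simp⟩) rfl
  let e : F ≃+* k := RingEquiv.ofBijective (q.comp F.subtype) ⟨hinj, hsurj⟩
  exact ⟨F.subtype.comp (e.symm : k →+* F), RingHom.ext fun x => e.apply_symm_apply x⟩

end Section

/-! ### Lifting homomorphisms along square-zero surjections. -/

section Lift

variable {V B C k : Type*} [CommRing V] [CommRing B] [CommRing C] [Field k] {p : ℕ}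
  [hp : Fact p.Prime]

/-- Homomorphisms from a ring `V` in which `p` is a regular element generating the kernel of a
surjection to a field lift along square-zero surjections whose kernel is killed by `p`. -/
theorem exists_lift_of_sq_zero {ρ : V →+* k} (hρ : Function.Surjective ρ)
    (hreg : ∀ v : V, (p : V) * v = 0 → v = 0) (hρp : ∀ v, ρ v = 0 ↔ (p : V) ∣ v)
    {g : B →+* C} (hg : Function.Surjective g) (hsq : ∀ x y, g x = 0 → g y = 0 → x * y = 0)
    (hp0 : ∀ x, g x = 0 → (p : B) * x = 0) (ψ : V →+* C) : ∃ φ : V →+* B, g.comp φ = ψ := by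
  -- The fibre product of `V` and `B` over `C`: a lift of `ψ` is the same as a section of its
  -- projection to `V`.
  let E : Subring (V × B) := RingHom.eqLocus (ψ.comp (RingHom.fst V B)) (g.comp (RingHom.snd V B))
  have hE : ∀ x, x ∈ E ↔ ψ x.1 = g x.2 := fun x => Iff.rfl
  let pr : E →+* V := (RingHom.fst V B).comp E.subtype
  have hpr : Function.Surjective pr := fun v => by
    obtain ⟨b, hb⟩ := hg (ψ v)
    exact ⟨⟨(v, b), hb.symm⟩, rfl⟩
  have hker : ∀ x : E, pr x = 0 → g x.1.2 = 0 := fun x hx => by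
    rw [← (hE _).mp x.2]
    change ψ (pr x) = 0
    rw [hx, map_zero]
  have hpker : ∀ x : E, pr x = 0 → (p : E) * x = 0 := fun x hx => by
    refine Subtype.ext (Prod.ext ?_ ?_)
    · have : x.1.1 = 0 := hx
      simp [this]
    · simpa using hp0 _ (hker x hx)
  let Ē := E ⧸ Ideal.span {(p : E)}
  let q : Ē →+* k := Ideal.Quotient.lift _ (ρ.comp pr) (fun x hx => by
    obtain ⟨c, rfl⟩ := Ideal.mem_span_singleton.mp hx
    rw [RingHom.comp_apply, hρp, map_mul, map_natCast]
    exact dvd_mul_right _ _)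
  have hq : ∀ x, q (Ideal.Quotient.mk _ x) = ρ (pr x) := fun x => Ideal.Quotient.lift_mk _ _ _
  have hqk : ∀ x, q x = 0 → ∃ y : E, pr y = 0 ∧ x = Ideal.Quotient.mk _ y := fun x hx => by
    obtain ⟨x, rfl⟩ := Ideal.Quotient.mk_surjective x
    rw [hq, hρp] at hx
    obtain ⟨v, hv⟩ := hx
    obtain ⟨e, rfl⟩ := hpr v
    refine ⟨x - p * e, by rw [map_sub, map_mul, map_natCast, hv, sub_self], ?_⟩
    rw [eq_comm, Ideal.Quotient.eq]
    rw [sub_sub_cancel_left]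
    exact neg_mem (Ideal.mem_span_singleton.mpr (dvd_mul_right _ _))
  have hnt : Nontrivial Ē := q.domain_nontrivial
  have hchar : CharP Ē p := by
    have : (p : Ē) = 0 := by
      rw [← map_natCast (Ideal.Quotient.mk (Ideal.span {(p : E)}))]
      exact Ideal.Quotient.eq_zero_iff_mem.mpr (Ideal.mem_span_singleton_self _)
    exact (CharP.charP_iff_prime_eq_zero hp.out).mpr this
  obtain ⟨s, hs⟩ := exists_section p (q := q)
    (fun a => by
      obtain ⟨v, rfl⟩ := hρ a
      obtain ⟨e, rfl⟩ := hpr v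
      exact ⟨Ideal.Quotient.mk _ e, hq e⟩)
    (fun x y hx hy => by
      obtain ⟨x, hx', rfl⟩ := hqk x hx
      obtain ⟨y, hy', rfl⟩ := hqk y hy
      rw [← map_mul]
      have : x * y = 0 := by
        refine Subtype.ext (Prod.ext ?_ (hsq _ _ (hker x hx') (hker y hy')))
        have : x.1.1 = 0 := hx'
        simp [this]
      rw [this, map_zero])
  have hqs : ∀ a, q (s a) = a := fun a => RingHom.congr_fun hs a
  -- Modulo `p` the projection becomes a square-zero extension of the field, split by `s`. The
  -- preimage of that splitting maps isomorphically onto `V`, as `p` kills the kernel of the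
  -- projection and is regular on `V`.
  let E' : Subring E := s.range.comap (Ideal.Quotient.mk (Ideal.span {(p : E)}))
  have hbij : Function.Bijective (pr.comp E'.subtype) := by
    constructor
    · rw [injective_iff_map_eq_zero]
      rintro ⟨x, a, ha⟩ hx
      replace hx : pr x = 0 := hx
      have h0 : a = 0 := by rw [← hqs a, ha, hq, hx, map_zero]
      rw [h0, map_zero, eq_comm, Ideal.Quotient.eq_zero_iff_mem] at ha
      obtain ⟨c, rfl⟩ := Ideal.mem_span_singleton.mp ha
      refine Subtype.ext (hpker c (hreg _ ?_))
      rwa [map_mul, map_natCast] at hx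
    · intro v
      obtain ⟨e, he⟩ := Ideal.Quotient.mk_surjective (s (ρ v))
      have h1 : ρ (pr e - v) = 0 := by rw [map_sub, ← hq, he, hqs, sub_self]
      obtain ⟨v', hv'⟩ := (hρp _).mp h1
      obtain ⟨e', rfl⟩ := hpr v'
      refine ⟨⟨e - p * e', ρ v, ?_⟩, ?_⟩
      · rw [← he, eq_comm, Ideal.Quotient.eq, sub_sub_cancel_left]
        exact neg_mem (Ideal.mem_span_singleton.mpr (dvd_mul_right _ _))
      · change pr (e - p * e') = v
        rw [map_sub, map_mul, map_natCast, ← hv', sub_sub_cancel]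
  let ε := RingEquiv.ofBijective (pr.comp E'.subtype) hbij
  refine ⟨((RingHom.snd V B).comp (E.subtype.comp E'.subtype)).comp (ε.symm : V →+* E'),
    RingHom.ext fun v => ?_⟩
  obtain ⟨x, rfl⟩ := ε.surjective v
  change g (((ε.symm (ε x)).1.1).2) = _
  rw [RingEquiv.symm_apply_apply]
  exact ((hE _).mp x.1.2).symm

end Lift

/-! ### Covering a local ring with nilpotent maximal ideal, up to its maximal ideal. -/

section Nilpotent

variable {R : Type u} [CommRing R] [IsLocalRing R]

open IsLocalRing

/-- The map to the residue field is lifted through the quotients by successive powers of `𝔪`; each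
kernel has square zero and is killed by `p ∈ 𝔪`. -/
theorem exists_hom_of_charP (p : ℕ) [hp : Fact p.Prime] [CharP (ResidueField R) p] {N : ℕ}
    (hN : maximalIdeal R ^ N = ⊥) :
    ∃ (V : Type u) (_ : CommRing V) (_ : IsDomain V) (_ : IsDiscreteValuationRing V)
      (φ : V →+* R), ∀ r, ∃ v, r - φ v ∈ maximalIdeal R := by
  obtain ⟨V, _, _, _, ρ, hρ, hp0, hρp⟩ := exists_discreteValuationRing (k := ResidueField R) p
  refine ⟨V, inferInstance, inferInstance, inferInstance, ?_⟩
  have hpm : (p : R) ∈ maximalIdeal R := by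
    rw [← residue_eq_zero_iff, map_natCast, CharP.cast_eq_zero]
  have key : ∀ n, ∃ φ : V →+* R ⧸ maximalIdeal R ^ (n + 1), ∀ v r,
      φ v = Ideal.Quotient.mk _ r → ρ v = residue R r := by
    intro n
    induction n with
    | zero =>
      have h0 : maximalIdeal R ^ (0 + 1) = maximalIdeal R := by rw [zero_add, pow_one]
      let e : ResidueField R ≃+* R ⧸ maximalIdeal R ^ (0 + 1) := Ideal.quotEquivOfEq h0.symm
      refine ⟨(e : ResidueField R →+* _).comp ρ, fun v r h => ?_⟩
      exact e.injective h
    | succ n ih =>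
      obtain ⟨ψ, hψ⟩ := ih
      have hle : maximalIdeal R ^ (n + 1 + 1) ≤ maximalIdeal R ^ (n + 1) :=
        Ideal.pow_le_pow_right (Nat.le_succ _)
      let g := Ideal.Quotient.factor hle
      have hgk : ∀ x, g (Ideal.Quotient.mk _ x) = 0 → x ∈ maximalIdeal R ^ (n + 1) := fun x hx => by
        rw [Ideal.Quotient.factor_mk] at hx
        exact Ideal.Quotient.eq_zero_iff_mem.mp hx
      obtain ⟨φ, hφ⟩ := exists_lift_of_sq_zero (p := p) hρ
        (fun v hv => (mul_eq_zero.mp hv).resolve_left hp0)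
        (fun v => ⟨hρp v, fun ⟨c, hc⟩ => by rw [hc, map_mul, map_natCast, CharP.cast_eq_zero,
          zero_mul]⟩) (Ideal.Quotient.factor_surjective hle)
        (fun x y hx hy => by
          obtain ⟨x, rfl⟩ := Ideal.Quotient.mk_surjective x
          obtain ⟨y, rfl⟩ := Ideal.Quotient.mk_surjective y
          rw [← map_mul, Ideal.Quotient.eq_zero_iff_mem]
          refine Ideal.pow_le_pow_right (by lia) (?_ : _ ∈ maximalIdeal R ^ ((n + 1) + (n + 1)))
          rw [pow_add]
          exact Ideal.mul_mem_mul (hgk x hx) (hgk y hy))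
        (fun x hx => by
          obtain ⟨x, rfl⟩ := Ideal.Quotient.mk_surjective x
          rw [← map_natCast (Ideal.Quotient.mk _), ← map_mul, Ideal.Quotient.eq_zero_iff_mem,
            pow_succ']
          exact Ideal.mul_mem_mul hpm (hgk x hx)) ψ
      refine ⟨φ, fun v r h => hψ v r ?_⟩
      rw [← hφ, RingHom.comp_apply, h, Ideal.Quotient.factor_mk]
  obtain ⟨φ, hφ⟩ := key N
  have hbot : maximalIdeal R ^ (N + 1) = ⊥ := by rw [pow_succ, hN, Ideal.bot_mul]
  let e : R ⧸ maximalIdeal R ^ (N + 1) ≃+* R :=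
    (Ideal.quotEquivOfEq hbot).trans (RingEquiv.quotientBot R)
  have he : ∀ r, e (Ideal.Quotient.mk _ r) = r := fun r => rfl
  refine ⟨(e : _ →+* R).comp φ, fun r => ?_⟩
  obtain ⟨v, hv⟩ := hρ (residue R r)
  refine ⟨v, ?_⟩
  rw [← residue_eq_zero_iff, map_sub, sub_eq_zero, ← hv]
  obtain ⟨r', hr'⟩ := Ideal.Quotient.mk_surjective (φ v)
  rw [hφ v r' hr'.symm, RingHom.comp_apply, ← hr']
  exact congrArg _ (he r').symm

theorem exists_hom_of_charZero [CharZero (ResidueField R)] {N : ℕ}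
    (hN : maximalIdeal R ^ N = ⊥) :
    ∃ (V : Type u) (_ : CommRing V) (_ : IsDomain V) (_ : IsDiscreteValuationRing V)
      (φ : V →+* R), ∀ r, ∃ v, r - φ v ∈ maximalIdeal R := by
  obtain ⟨_⟩ : Nonempty (Algebra ℚ R) := by
    rw [EqualCharZero.nonempty_algebraRat_iff]
    intro I hI
    let g : R ⧸ I →+* ResidueField R := Ideal.Quotient.factor (le_maximalIdeal hI)
    exact g.charZero
  obtain ⟨s, hs⟩ := exists_isTranscendenceBasis ℚ (ResidueField R)
  have hsep : Algebra.IsSeparable (IntermediateField.adjoin ℚ (Set.range ((↑) : s → ResidueField R)))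
      (ResidueField R) := by
    have := hs.isAlgebraic_field
    infer_instance
  have hsm : Algebra.FormallySmooth ℚ (ResidueField R) :=
    .of_algebraicIndependent_of_isSeparable hs.1
  obtain ⟨f, hf⟩ := Algebra.FormallySmooth.exists_lift (R := ℚ) (maximalIdeal R) ⟨N, hN⟩
    (RingHom.toRatAlgHom (RingHom.id (ResidueField R)) : ResidueField R →ₐ[ℚ] R ⧸ maximalIdeal R)
  -- Formal smoothness has given a coefficient field. The power series ring only supplies a discrete
  -- valuation ring above it, with the variable sent to `0`.
  refine ⟨PowerSeries (ResidueField R), inferInstance, inferInstance, inferInstance,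
    (f : ResidueField R →+* R).comp PowerSeries.constantCoeff, fun r => ?_⟩
  refine ⟨PowerSeries.C (residue R r), ?_⟩
  rw [← residue_eq_zero_iff, map_sub, sub_eq_zero, RingHom.comp_apply, PowerSeries.constantCoeff_C]
  exact (AlgHom.congr_fun hf (residue R r)).symm

/-- A local ring with nilpotent maximal ideal is covered by a discrete valuation ring, up to its
maximal ideal. -/
theorem exists_hom {N : ℕ} (hN : maximalIdeal R ^ N = ⊥) :
    ∃ (V : Type u) (_ : CommRing V) (_ : IsDomain V) (_ : IsDiscreteValuationRing V)
      (φ : V →+* R), ∀ r, ∃ v, r - φ v ∈ maximalIdeal R := by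
  obtain ⟨p, hp⟩ := CharP.exists (ResidueField R)
  rcases CharP.char_is_prime_or_zero (ResidueField R) p with h | rfl
  · have : Fact p.Prime := ⟨h⟩
    exact exists_hom_of_charP p hN
  · have := CharP.charP_to_charZero (ResidueField R)
    exact exists_hom_of_charZero hN

end Nilpotent

end CohenRing

end

/-! ### Vanishing of the determinant in positive dimension. -/

namespace IsLocalRing

variable {R : Type*} [CommRing R] [IsLocalRing R] [IsNoetherianRing R]

/-- In a Noetherian local ring of positive dimension, a square matrix annihilating a system of
generators of the maximal ideal has vanishing determinant. -/
theorem det_eq_zero_of_mulVec_eq_zero {σ : Type*} [Fintype σ] [DecidableEq σ]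
    (hdim : 0 < ringKrullDim R) {z : σ → R} (hz : Ideal.span (Set.range z) = maximalIdeal R)
    {A : Matrix σ σ R} (hA : A.mulVec z = 0) : A.det = 0 := by
  -- If two consecutive powers coincided, Nakayama would make `𝔪` nilpotent and the ring Artinian.
  have hne : ∀ N, maximalIdeal R ^ (N + 1) < maximalIdeal R ^ N := fun N => by
    refine lt_of_le_of_ne (Ideal.pow_le_pow_right (Nat.le_succ N)) fun h => hdim.not_ge ?_
    have h1 : maximalIdeal R ^ N = ⊥ := by
      refine Submodule.eq_bot_of_le_smul_of_le_jacobson_bot (maximalIdeal R) _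
        (IsNoetherian.noetherian _) ?_ (maximalIdeal_le_jacobson _)
      rw [smul_eq_mul, ← pow_succ', h]
    have : IsArtinianRing R := (isArtinianRing_iff_isNilpotent_maximalIdeal R).mpr ⟨N, h1⟩
    exact Ring.krullDimLE_iff.mp (isArtinianRing_iff_krullDimLE_zero.mp this)
  have key : ∀ N, A.det ∈ maximalIdeal R ^ N := fun N => by
    set J := maximalIdeal R ^ (N + 1) with hJ
    have hJt : J ≠ ⊤ := (hne N |>.trans_le le_top).ne
    have : Nontrivial (R ⧸ J) := Ideal.Quotient.nontrivial_iff.mpr hJt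
    have hloc : IsLocalRing (R ⧸ J) :=
      IsLocalRing.of_surjective' (Ideal.Quotient.mk J) Ideal.Quotient.mk_surjective
    have hmap : (maximalIdeal R).map (Ideal.Quotient.mk J) = maximalIdeal (R ⧸ J) :=
      map_maximalIdeal_of_surjective _ Ideal.Quotient.mk_surjective
    have hpow : ∀ i, maximalIdeal (R ⧸ J) ^ i = (maximalIdeal R ^ i).map (Ideal.Quotient.mk J) :=
      fun i => by rw [Ideal.map_pow, hmap]
    have hbot : maximalIdeal (R ⧸ J) ^ (N + 1) = ⊥ := by rw [hpow, Ideal.map_quotient_self]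
    obtain ⟨V, _, _, _, φ, hφ⟩ := CohenRing.exists_hom hbot
    have h1 := PurePower.det_mem_pow_of_mulVec_eq_zero (z := fun i => Ideal.Quotient.mk J (z i))
      (N := N) (by
        rw [← hmap, ← hz, Ideal.map_span]
        congr 1
        exact Set.range_comp _ _) hbot
      (by
        rw [hpow, Ne, Ideal.map_eq_bot_iff_le_ker, Ideal.mk_ker]
        exact (hne N).not_ge) φ hφ (A := A.map (Ideal.Quotient.mk J)) (by
        ext i
        have : A.mulVec z i = 0 := congrFun hA i
        simp only [Matrix.mulVec, dotProduct, Matrix.map_apply, Pi.zero_apply] at this ⊢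
        rw [← map_zero (Ideal.Quotient.mk J), ← this, map_sum]
        simp only [map_mul])
    have h2 : Ideal.Quotient.mk J A.det ∈ (maximalIdeal R ^ N).map (Ideal.Quotient.mk J) := by
      rw [← hpow, RingHom.map_det, RingHom.mapMatrix_apply]
      exact h1
    rw [Ideal.mem_quotient_iff_mem (Ideal.pow_le_pow_right (Nat.le_succ N))] at h2
    exact h2
  have h := Ideal.iInf_pow_eq_bot_of_isLocalRing (maximalIdeal R) Ideal.IsPrime.ne_top'
  rw [← Ideal.mem_bot, ← h]
  exact Ideal.mem_iInf.mpr key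

end IsLocalRing

section

open IsLocalRing
open Ideal hiding ResidueField sum_mem

namespace IdealReduction

/-! ### Powers of ideals and evaluation of forms. -/

section General

variable {R : Type*} [CommRing R]

theorem radical_height (I : Ideal R) : I.radical.height = I.height := by
  unfold Ideal.height
  simp only [Ideal.radical_minimalPrimes]

/-- The only monomial of degree `n + 1` not involving `J` is the pure power of `x`, so a reduction
equation need only be tested on that power. -/
theorem sup_span_singleton_pow_le (J : Ideal R) (x : R) {I : Ideal R}
    (hI : I = J ⊔ span {x}) (n : ℕ) : I ^ (n + 1) ≤ J * I ^ n ⊔ span {x ^ (n + 1)} := by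
  induction n with
  | zero => simp [hI]
  | succ n ih =>
    have hJ : J ≤ I := hI ▸ le_sup_left
    calc I ^ (n + 1 + 1) = I ^ (n + 1) * J ⊔ I ^ (n + 1) * span {x} := by
          rw [← Ideal.mul_sup, ← hI, pow_succ I (n + 1)]
      _ ≤ J * I ^ (n + 1) ⊔ span {x ^ (n + 1 + 1)} := by
          refine sup_le ?_ ?_
          · rw [mul_comm]; exact le_sup_left
          · refine (Ideal.mul_mono_left ih).trans ?_
            rw [Ideal.sup_mul, mul_assoc, span_singleton_mul_span_singleton, ← pow_succ]
            refine sup_le_sup_right (Ideal.mul_mono_right ?_) _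
            rw [pow_succ]
            refine Ideal.mul_mono_right ?_
            rw [hI]
            exact le_sup_right

theorem eval_mem_pow_of_isHomogeneous {ι : Type*} {I : Ideal R} {ω : ι → R} (hω : ∀ i, ω i ∈ I)
    {n : ℕ} {F : MvPolynomial ι R} (hF : F.IsHomogeneous n) : MvPolynomial.eval ω F ∈ I ^ n :=
  Ideal.pow_right_mono (Ideal.span_le.mpr (by rintro _ ⟨i, rfl⟩; exact hω i)) n
    ((Ideal.mem_span_pow_iff_exists_isHomogeneous ω _).mpr ⟨F, hF, rfl⟩)

/-- Evaluations of a form at points congruent modulo `J`. -/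
theorem eval_sub_eval_mem {ι : Type*} {I J : Ideal R} {ω η : ι → R} (hω : ∀ i, ω i ∈ I)
    (hη : ∀ i, η i ∈ I) (h : ∀ i, ω i - η i ∈ J) {n : ℕ} {F : MvPolynomial ι R}
    (hF : F.IsHomogeneous (n + 1)) :
    MvPolynomial.eval ω F - MvPolynomial.eval η F ∈ J * I ^ n := by
  classical
  have key : ∀ α : ι →₀ ℕ, ∀ n, α.degree = n + 1 → (MvPolynomial.eval ω (MvPolynomial.monomial α 1)
      - MvPolynomial.eval η (MvPolynomial.monomial α 1)) ∈ J * I ^ n := by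
    intro α n
    induction n using Nat.strong_induction_on generalizing α with
    | _ n ih =>
      intro hα
      obtain ⟨i, hi⟩ : ∃ i, α i ≠ 0 := by
        by_contra! h0
        rw [show α = 0 from Finsupp.ext h0] at hα
        simp at hα
      have hle : Finsupp.single i 1 ≤ α := by
        rw [Finsupp.single_le_iff]; lia
      obtain ⟨β, rfl⟩ := exists_add_of_le hle
      have hβ : β.degree = n := by
        rw [map_add, Finsupp.degree_single] at hα; lia
      have hmul : ∀ ξ : ι → R, MvPolynomial.eval ξ (MvPolynomial.monomial (Finsupp.single i 1 + β) 1)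
          = ξ i * MvPolynomial.eval ξ (MvPolynomial.monomial β 1) := fun ξ => by
        rw [← MvPolynomial.eval_X (f := ξ) i, ← map_mul, MvPolynomial.X,
          MvPolynomial.monomial_mul, one_mul]
      rw [hmul, hmul]
      have h1 : (ω i - η i) * MvPolynomial.eval ω (MvPolynomial.monomial β 1) ∈ J * I ^ n :=
        Ideal.mul_mem_mul (h i)
          (eval_mem_pow_of_isHomogeneous hω (MvPolynomial.isHomogeneous_monomial 1 hβ))
      have h2 : η i * (MvPolynomial.eval ω (MvPolynomial.monomial β 1) -
          MvPolynomial.eval η (MvPolynomial.monomial β 1)) ∈ J * I ^ n := by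
        rcases n with _ | n
        · rw [(Finsupp.degree_eq_zero_iff β).mp hβ]
          simp
        · have h2 := Ideal.mul_mem_mul (ih n (Nat.lt_succ_self n) β hβ) (hη i)
          rwa [mul_assoc, ← pow_succ, mul_comm (_ - _)] at h2
      convert add_mem h1 h2 using 1
      ring
  have hsum : ∀ ξ : ι → R, MvPolynomial.eval ξ F =
      ∑ α ∈ F.support, F.coeff α * MvPolynomial.eval ξ (MvPolynomial.monomial α 1) := fun ξ => by
    conv_lhs => rw [F.as_sum]
    rw [map_sum]
    refine Finset.sum_congr rfl fun α _ => ?_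
    simp [MvPolynomial.eval_monomial]
  rw [hsum, hsum, ← Finset.sum_sub_distrib]
  refine sum_mem fun α hα => ?_
  rw [← mul_sub]
  refine Ideal.mul_mem_left _ _ (key α n ?_)
  by_contra hc
  exact (MvPolynomial.mem_support_iff.mp hα) (hF.coeff_eq_zero hc)

theorem eval_mul_right_of_isHomogeneous {ι : Type*} {n : ℕ} {F : MvPolynomial ι R}
    (hF : F.IsHomogeneous n) (μ : ι → R) (y : R) :
    MvPolynomial.eval (fun i => μ i * y) F = MvPolynomial.eval μ F * y ^ n := by
  rw [MvPolynomial.eval_eq, MvPolynomial.eval_eq, Finset.sum_mul]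
  refine Finset.sum_congr rfl fun α hα => ?_
  have h1 : ∑ i ∈ α.support, α i = n := by
    by_contra hc
    exact MvPolynomial.mem_support_iff.mp hα (hF.coeff_eq_zero hc)
  simp only [mul_pow, Finset.prod_mul_distrib, Finset.prod_pow_eq_pow_sum, h1, mul_assoc]

/-- The missing pure power of the zeroth variable records membership in `Q I^n` rather than just in
`I^(n+1)`: every monomial involves some `a i`. -/
theorem exists_isHomogeneous_of_mem_mul {d n : ℕ} {x : R} {a : Fin d → R} {I : Ideal R}
    (hI : I = span (Set.range (Fin.cons x a : Fin (d + 1) → R))) {w : R}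
    (hw : w ∈ span (Set.range a) * I ^ n) :
    ∃ F : MvPolynomial (Fin (d + 1)) R, F.IsHomogeneous (n + 1) ∧
      F.coeff (Finsupp.single 0 (n + 1)) = 0 ∧
      MvPolynomial.eval (Fin.cons x a : Fin (d + 1) → R) F = w := by
  classical
  rw [mul_comm, ← smul_eq_mul] at hw
  obtain ⟨c, hc, rfl⟩ := (Submodule.mem_ideal_smul_span_iff_exists_sum _ _ _).mp hw
  have h1 : ∀ i, ∃ G : MvPolynomial (Fin (d + 1)) R, G.IsHomogeneous n ∧
      MvPolynomial.eval (Fin.cons x a : Fin (d + 1) → R) G = c i := fun i => by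
    rw [← Ideal.mem_span_pow_iff_exists_isHomogeneous, ← hI]
    exact hc i
  choose G hG hGc using h1
  refine ⟨∑ i, MvPolynomial.X i.succ * G i, ?_, ?_, ?_⟩
  · refine MvPolynomial.IsHomogeneous.sum _ _ _ fun i _ => ?_
    rw [add_comm n 1]
    exact (MvPolynomial.isHomogeneous_X R _).mul (hG i)
  · rw [MvPolynomial.coeff_sum]
    refine Finset.sum_eq_zero fun i _ => ?_
    rw [MvPolynomial.coeff_X_mul', if_neg]
    rw [Finsupp.mem_support_iff, not_not, Finsupp.single_eq_of_ne (Fin.succ_ne_zero i)]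
  · rw [map_sum, Finsupp.sum_fintype _ _ (by simp)]
    refine Finset.sum_congr rfl fun i _ => ?_
    rw [map_mul, MvPolynomial.eval_X, hGc, Fin.cons_succ, smul_eq_mul, mul_comm]

end General

/-! ### Reductions in a local ring. -/

section Local

variable {R : Type*} [CommRing R] [IsLocalRing R]

theorem mem_maximalIdeal_mul_of_coeff_mem {d n : ℕ} {x : R} {a : Fin d → R} {I : Ideal R}
    (hx : x ∈ I) (ha : ∀ i, a i ∈ I) {F : MvPolynomial (Fin (d + 1)) R}
    (hF : F.IsHomogeneous (n + 1)) (hF0 : F.coeff (Finsupp.single 0 (n + 1)) = 0)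
    (hc : ∀ α, F.coeff α ∈ maximalIdeal R) :
    MvPolynomial.eval (Fin.cons x a : Fin (d + 1) → R) F ∈
      maximalIdeal R * (span (Set.range a) * I ^ n) := by
  set ω : Fin (d + 1) → R := Fin.cons x a with hω
  have hωI : ∀ i, ω i ∈ I := Fin.cases hx ha
  rw [F.as_sum, map_sum]
  refine sum_mem fun α hα => ?_
  have hdeg : α.degree = n + 1 := by
    by_contra hc
    exact MvPolynomial.mem_support_iff.mp hα (hF.coeff_eq_zero hc)
  obtain ⟨i, hi⟩ : ∃ i : Fin d, α i.succ ≠ 0 := by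
    by_contra! h0
    have h1 : α = Finsupp.single 0 (α 0) := by
      ext i
      refine Fin.cases ?_ (fun i => ?_) i
      · rw [Finsupp.single_eq_same]
      · rw [h0, Finsupp.single_eq_of_ne (Fin.succ_ne_zero i)]
    rw [h1, Finsupp.degree_single] at hdeg
    rw [hdeg] at h1
    exact MvPolynomial.mem_support_iff.mp hα (h1 ▸ hF0)
  have hle : Finsupp.single i.succ 1 ≤ α := by
    rw [Finsupp.single_le_iff]; lia
  obtain ⟨β, rfl⟩ := exists_add_of_le hle
  have hβ : β.degree = n := by
    rw [map_add, Finsupp.degree_single] at hdeg; lia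
  have h1 : MvPolynomial.monomial (Finsupp.single i.succ 1 + β)
      (F.coeff (Finsupp.single i.succ 1 + β)) =
      MvPolynomial.C (F.coeff (Finsupp.single i.succ 1 + β)) *
        (MvPolynomial.X i.succ * MvPolynomial.monomial β 1) := by
    rw [MvPolynomial.X, MvPolynomial.monomial_mul, MvPolynomial.C_mul_monomial, mul_one, mul_one]
  rw [h1, map_mul, map_mul, MvPolynomial.eval_C, MvPolynomial.eval_X]
  refine Ideal.mul_mem_mul (hc _) (Ideal.mul_mem_mul (Ideal.subset_span ⟨i, rfl⟩) ?_)
  exact eval_mem_pow_of_isHomogeneous hωI (MvPolynomial.isHomogeneous_monomial 1 hβ)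

/-- A module of length one is simple, so its annihilator is the maximal ideal. -/
theorem maximalIdeal_mul_le_of_length_eq_one {G H : Ideal R}
    (h : Module.length R (G ⧸ Submodule.submoduleOf H G) = 1) : maximalIdeal R * G ≤ H := by
  have hs : IsSimpleModule R (G ⧸ Submodule.submoduleOf H G) := Module.length_eq_one_iff.mp h
  have hann : Module.annihilator R (G ⧸ Submodule.submoduleOf H G) = maximalIdeal R :=
    eq_maximalIdeal (IsSimpleModule.annihilator_isMaximal ..)
  rw [Ideal.mul_le]
  intro r hr g hg
  rw [← hann, Module.mem_annihilator] at hr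
  have := hr (Submodule.Quotient.mk ⟨g, hg⟩)
  rw [← Submodule.Quotient.mk_smul, Submodule.Quotient.mk_eq_zero] at this
  exact this

variable [IsNoetherianRing R]

theorem le_of_le_sup_maximalIdeal_mul {I J : Ideal R} (h : I ≤ J ⊔ maximalIdeal R * I) : I ≤ J :=
  Submodule.le_of_le_smul_of_le_jacobson_bot (IsNoetherian.noetherian I)
    (maximalIdeal_le_jacobson _) h

/-- A reduction of an `𝔪`-primary ideal generated by `dim R` elements extends by one element to a
generating set of the ideal, if the latter is an almost complete intersection. -/
theorem exists_eq_sup_span_singleton {I : Ideal R} {d : ℕ} (hI : I.radical = maximalIdeal R)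
    (hdim : ringKrullDim R = d) (hd : 1 ≤ d) (hν : I.spanFinrank = d + 1) {a : Fin d → R}
    (ha : span (Set.range a) ≤ I) {k : ℕ} (hk : I ^ (k + 1) = span (Set.range a) * I ^ k) :
    ∃ x, I = span (Set.range a) ⊔ span {x} := by
  classical
  have haI : ∀ i, a i ∈ I := fun i => ha (subset_span ⟨i, rfl⟩)
  have hIm : I ≤ maximalIdeal R := hI ▸ le_radical
  let Vm := I ⧸ (maximalIdeal R) • (⊤ : Submodule R I)
  let : Module (R ⧸ maximalIdeal R) Vm := inferInstance
  let : Field (R ⧸ maximalIdeal R) := Ideal.Quotient.field _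
  have hrank : Module.finrank (R ⧸ maximalIdeal R) Vm = d + 1 := by
    rw [← hν]
    exact (IsLocalRing.spanFinrank_eq_finrank_quotient I (IsNoetherian.noetherian I)).symm
  let π : I →ₗ[R] Vm := Submodule.mkQ _
  have hspan : ∀ (T : Set I) (y : I), π y ∈ Submodule.span (R ⧸ maximalIdeal R) (π '' T) →
      (y : R) ∈ span (Subtype.val '' T) ⊔ maximalIdeal R * I := by
    intro T y hy
    have h1 : π y ∈ (Submodule.span (R ⧸ maximalIdeal R) (π '' T)).restrictScalars R := hy
    rw [Submodule.restrictScalars_span R _ Ideal.Quotient.mk_surjective, ← Submodule.map_span] at h1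
    obtain ⟨t, ht, hty⟩ := h1
    have h2 : y - t ∈ (maximalIdeal R) • (⊤ : Submodule R I) :=
      (Submodule.Quotient.eq _).mp hty.symm
    have h3 : (y : R) = (t : R) + ((y - t : I) : R) := by simp
    rw [h3]
    refine Submodule.add_mem_sup ?_ ?_
    · have := Submodule.mem_map_of_mem (f := I.subtype) ht
      rw [Submodule.map_span] at this
      exact this
    · have := Submodule.mem_map_of_mem (f := I.subtype) h2
      rw [Submodule.map_smul'', Submodule.map_top, Submodule.range_subtype] at this
      exact this
  let v : Fin d → Vm := fun i => π ⟨a i, haI i⟩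
  -- If one `a i` were redundant modulo `𝔪 I`, the remaining `d - 1` would still generate a
  -- reduction by Nakayama, hence an `𝔪`-primary ideal, against Krull's height theorem.
  have hv : LinearIndependent (R ⧸ maximalIdeal R) v := by
    rw [linearIndependent_iff_notMem_span]
    intro i hi
    set T := (fun i => (⟨a i, haI i⟩ : I)) '' (Set.univ \ {i})
    have h1 := hspan T ⟨a i, haI i⟩ (by rw [← Set.image_comp]; exact hi)
    set Q' := span (Subtype.val '' T) with hQ'
    have hQQ' : span (Set.range a) ≤ Q' ⊔ maximalIdeal R * I := by
      rw [span_le]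
      rintro _ ⟨j, rfl⟩
      by_cases hj : j = i
      · subst hj; exact h1
      · exact Submodule.mem_sup_left (subset_span ⟨_, ⟨j, ⟨trivial, hj⟩, rfl⟩, rfl⟩)
    have hQ'I : Q' ≤ I := by
      rw [hQ', span_le]
      rintro _ ⟨y, -, rfl⟩
      exact y.2
    have h2 : I ^ (k + 1) ≤ Q' * I ^ k := by
      refine le_of_le_sup_maximalIdeal_mul ?_
      conv_lhs => rw [hk]
      refine (Ideal.mul_mono_left hQQ').trans ?_
      rw [Ideal.sup_mul, mul_assoc, ← pow_succ']
    have hrad : Q'.radical = maximalIdeal R := by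
      refine le_antisymm (hI ▸ radical_mono hQ'I) ?_
      rw [← hI, ← radical_pow I (Nat.succ_ne_zero k)]
      exact radical_mono (h2.trans Ideal.mul_le_left)
    have hht : (d : ℕ∞) ≤ Q'.spanFinrank := by
      refine le_trans ?_ (Q'.height_le_spanFinrank ((hQ'I.trans hIm).trans_lt
        (lt_top_iff_ne_top.mpr Ideal.IsPrime.ne_top')).ne)
      rw [← radical_height, hrad, ← WithBot.coe_le_coe, maximalIdeal_height_eq_ringKrullDim, hdim]
      rfl
    have hcard : Q'.spanFinrank ≤ d - 1 := by
      refine (Submodule.spanFinrank_span_le_ncard_of_finite (Set.toFinite _)).trans ?_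
      rw [← Set.image_comp]
      refine (Set.ncard_image_le (Set.toFinite _)).trans ?_
      rw [Set.ncard_sdiff_singleton_of_mem (Set.mem_univ i), Set.ncard_univ, Nat.card_fin]
    have : d ≤ Q'.spanFinrank := by exact_mod_cast hht
    lia
  obtain ⟨w, hw⟩ : ∃ w : Vm, w ∉ Submodule.span (R ⧸ maximalIdeal R) (Set.range v) := by
    by_contra! hc
    have h1 := finrank_span_eq_card hv
    rw [(Submodule.eq_top_iff'.mpr hc), finrank_top, hrank, Fintype.card_fin] at h1
    lia
  obtain ⟨x, rfl⟩ := Submodule.mkQ_surjective _ w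
  have : FiniteDimensional (R ⧸ maximalIdeal R) Vm := .of_finrank_pos (by rw [hrank]; lia)
  have htop := (linearIndependent_finCons.mpr ⟨hv, hw⟩).span_eq_top_of_card_eq_finrank'
    (by rw [hrank, Fintype.card_fin])
  refine ⟨x, le_antisymm (le_of_le_sup_maximalIdeal_mul fun y hy => ?_)
    (sup_le ha ((span_singleton_le_iff_mem _).mpr x.2))⟩
  have h1 := hspan (Set.range (Fin.cons x fun i => ⟨a i, haI i⟩)) ⟨y, hy⟩ (by
    rw [← Set.range_comp]
    have : π ∘ (Fin.cons x fun i => (⟨a i, haI i⟩ : I)) = Fin.cons (Submodule.mkQ _ x) v := by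
      funext i
      refine Fin.cases rfl (fun i => rfl) i
    rw [this, htop]
    trivial)
  have h2 : span (Subtype.val '' Set.range (Fin.cons x fun i => (⟨a i, haI i⟩ : I))) ≤
      span (Set.range a) ⊔ span {(x : R)} := by
    rw [Ideal.span_le]
    rintro _ ⟨_, ⟨i, rfl⟩, rfl⟩
    refine Fin.cases ?_ (fun i => ?_) i
    · exact Submodule.mem_sup_right (Ideal.mem_span_singleton_self _)
    · exact Submodule.mem_sup_left (Ideal.subset_span ⟨i, rfl⟩)
  exact sup_le_sup_right h2 _ h1

/-- If multiplication by `x ^ n` maps `𝔪` into `𝔪 * Q * I ^ (n - 1)`, then a power of `x` is integral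
over `Q`. -/
theorem pow_mul_mem_of_forall_mul_mem (hdim : 0 < ringKrullDim R) {I Q : Ideal R} (hQI : Q ≤ I)
    {s : ℕ} {z : Fin s → R} (hz : span (Set.range z) = maximalIdeal R) {n : ℕ}
    {x : R} (hx : x ∈ I)
    (h : ∀ i, x ^ (n + 1) * z i ∈ maximalIdeal R * (Q * I ^ n)) :
    x ^ ((n + 1) * s) ∈ Q * I ^ ((n + 1) * s - 1) := by
  classical
  have h1 : ∀ i, ∃ c : Fin s → R, (∀ j, c j ∈ Q * I ^ n) ∧ x ^ (n + 1) * z i = ∑ j, c j * z j := by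
    intro i
    have h2 := h i
    rw [mul_comm, ← hz, ← smul_eq_mul] at h2
    obtain ⟨c, hc, hci⟩ := (Submodule.mem_ideal_smul_span_iff_exists_sum _ _ _).mp h2
    refine ⟨c, hc, ?_⟩
    rw [← hci, Finsupp.sum_fintype _ _ (by simp)]
    rfl
  choose c hc hci using h1
  let B : Matrix (Fin s) (Fin s) R := Matrix.of c
  -- The determinant is the characteristic polynomial of `B` at `x ^ (n + 1)`, so its vanishing is a
  -- monic equation whose coefficient of index `i` lies in `(Q I^n)^(s - i)`.
  have hdet : (Matrix.scalar (Fin s) (x ^ (n + 1)) - B).det = 0 := by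
    refine det_eq_zero_of_mulVec_eq_zero hdim hz ?_
    rw [Matrix.sub_mulVec]
    ext i
    have : (Matrix.scalar (Fin s) (x ^ (n + 1))).mulVec z i = x ^ (n + 1) * z i := by
      simp [Matrix.scalar_apply, Matrix.mulVec_diagonal]
    rw [Pi.sub_apply, this, hci, Pi.zero_apply, sub_eq_zero]
    rfl
  rw [← Matrix.eval_charpoly, Polynomial.eval_eq_sum_range, Matrix.charpoly_natDegree_eq_dim,
    Fintype.card_fin, Finset.sum_range_succ] at hdet
  have hlead : B.charpoly.coeff s = 1 := by
    have := B.charpoly_monic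
    rwa [Polynomial.Monic, Polynomial.leadingCoeff, Matrix.charpoly_natDegree_eq_dim,
      Fintype.card_fin] at this
  rw [hlead, one_mul, ← pow_mul, add_comm, ← eq_neg_iff_add_eq_zero] at hdet
  rw [hdet]
  refine neg_mem (sum_mem fun i hi => ?_)
  have hi' := Finset.mem_range.mp hi
  have h3 : B.charpoly.coeff i ∈ (Q * I ^ n) ^ (s - i) := by
    have := Matrix.coeff_charpoly_mem_ideal_pow (M := B) (I := Q * I ^ n) (fun i j => hc i j) i
    rwa [Fintype.card_fin] at this
  have h4 : (x ^ (n + 1)) ^ i ∈ I ^ ((n + 1) * i) := by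
    rw [← pow_mul]; exact pow_mem_pow hx _
  refine (?_ : (Q * I ^ n) ^ (s - i) * I ^ ((n + 1) * i) ≤ _) (mul_mem_mul h3 h4)
  obtain ⟨t, ht⟩ : ∃ t, s = i + (t + 1) := ⟨s - i - 1, by lia⟩
  have h5 : s - i = t + 1 := by lia
  have h6 : (n + 1) * s - 1 = n + ((n + 1) * t + (n + 1) * i) := by
    rw [ht]
    have : (n + 1) * (i + (t + 1)) = (n + 1) * t + (n + 1) * i + n + 1 := by ring
    lia
  rw [h5, h6, pow_succ', pow_add, pow_add, mul_assoc, mul_assoc]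
  refine Ideal.mul_mono_right (Ideal.mul_mono_right (Ideal.mul_mono_left ?_))
  rw [pow_mul]
  refine Ideal.pow_right_mono ?_ t
  rw [pow_succ']
  exact Ideal.mul_mono_left hQI

/-- A nontrivial homogeneous relation between the generators of `I` modulo `𝔪` yields a reduction
with one generator less. -/
theorem exists_pow_eq_mul_of_eval_mem [Infinite (ResidueField R)] {d n : ℕ} {ω : Fin (d + 1) → R}
    {I : Ideal R} (hI : I = span (Set.range ω)) {F : MvPolynomial (Fin (d + 1)) R}
    (hF : F.IsHomogeneous (n + 1)) (hF0 : MvPolynomial.map (residue R) F ≠ 0)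
    (hFω : MvPolynomial.eval ω F ∈ maximalIdeal R * I ^ (n + 1)) :
    ∃ b : Fin d → R, span (Set.range b) ≤ I ∧ I ^ (n + 1) = span (Set.range b) * I ^ n := by
  have hω : ∀ i, ω i ∈ I := fun i => hI ▸ subset_span ⟨i, rfl⟩
  obtain ⟨l, hl⟩ : ∃ l : Fin (d + 1) → ResidueField R,
      MvPolynomial.eval l (MvPolynomial.map (residue R) F) ≠ 0 := by
    by_contra! hc
    exact hF0 ((hF.map _).eq_zero_of_forall_eval_eq_zero hc)
  obtain ⟨j, hj⟩ : ∃ j, l j ≠ 0 := by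
    by_contra! hc
    refine hl ?_
    have h1 := eval_mul_right_of_isHomogeneous (hF.map (residue R)) l 0
    rw [pow_succ, mul_zero, mul_zero] at h1
    rw [← h1]
    congr 2
    funext i
    rw [hc i, zero_mul]
  -- Scaling the point so that its coordinate `j` is `1` does not affect nonvanishing of a form, and
  -- allows a lift with `μ j` exactly `1`.
  obtain ⟨μ, hμ, hμj⟩ : ∃ μ : Fin (d + 1) → R, (∀ i, residue R (μ i) = l i * (l j)⁻¹) ∧ μ j = 1 := by
    choose μ hμ using fun i => residue_surjective (R := R) (l i * (l j)⁻¹)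
    refine ⟨Function.update μ j 1, fun i => ?_, Function.update_self j 1 μ⟩
    by_cases hij : i = j
    · rw [hij, Function.update_self, map_one, mul_inv_cancel₀ hj]
    · rw [Function.update_of_ne hij, hμ]
  have hμF : IsUnit (MvPolynomial.eval μ F) := by
    have h1 : residue R (MvPolynomial.eval μ F) ≠ 0 := by
      have h2 : residue R (MvPolynomial.eval μ F) =
          MvPolynomial.eval (fun i => l i * (l j)⁻¹) (MvPolynomial.map (residue R) F) := by
        rw [MvPolynomial.eval_map, ← MvPolynomial.eval₂_id, MvPolynomial.eval₂_comp_left,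
          RingHom.comp_id]
        congr 1
        funext i
        exact hμ i
      rw [h2, eval_mul_right_of_isHomogeneous (hF.map _)]
      exact mul_ne_zero hl (pow_ne_zero _ (inv_ne_zero hj))
    by_contra hc
    exact h1 ((residue_eq_zero_iff _).mpr ((mem_maximalIdeal _).mpr hc))
  set b : Fin d → R := fun i => ω (j.succAbove i) - μ (j.succAbove i) * ω j with hb
  set J := span (Set.range b) with hJ
  have hJI : J ≤ I := by
    rw [hJ, Ideal.span_le]
    rintro _ ⟨i, rfl⟩
    exact sub_mem (hω _) (Ideal.mul_mem_left _ _ (hω _))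
  have hωJ : ∀ i, ω i - μ i * ω j ∈ J := fun i => by
    rcases Fin.eq_self_or_eq_succAbove j i with rfl | ⟨i, rfl⟩
    · rw [hμj, one_mul, sub_self]; exact zero_mem _
    · exact Ideal.subset_span ⟨i, rfl⟩
  have hIJ : I = J ⊔ span {ω j} := by
    refine le_antisymm ?_ (sup_le hJI ((Ideal.span_singleton_le_iff_mem _).mpr (hω j)))
    rw [hI, Ideal.span_le]
    rintro _ ⟨i, rfl⟩
    have h1 := Submodule.add_mem_sup (hωJ i)
      (Ideal.mul_mem_left _ (μ i) (Ideal.mem_span_singleton_self (ω j)))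
    rwa [sub_add_cancel] at h1
  refine ⟨b, hJI, le_antisymm (le_of_le_sup_maximalIdeal_mul ?_) ?_⟩
  · refine (sup_span_singleton_pow_le J (ω j) hIJ n).trans (sup_le le_sup_left ?_)
    -- Modulo `J` the generators are `μ i * ω j`, so `F(ω) ≡ F(μ) * ω j ^ (n + 1)` modulo `J I^n`,
    -- with `F(μ)` a unit. The error term in `𝔪 I^(n+1)` has been allowed for by Nakayama.
    rw [Ideal.span_singleton_le_iff_mem, ← Ideal.unit_mul_mem_iff_mem _ hμF,
      ← eval_mul_right_of_isHomogeneous hF]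
    have h1 := eval_sub_eval_mem hω (fun i => Ideal.mul_mem_left _ (μ i) (hω j)) hωJ hF
    have h2 := Submodule.add_mem_sup (neg_mem h1) hFω
    rwa [neg_sub, sub_add_cancel] at h2
  · rw [pow_succ']
    exact Ideal.mul_mono_left hJI

/-- If the quotient `I ^ (n + 1) / Q * I ^ n` is killed by `𝔪`, then some reduction generated by `d`
elements has small reduction number. -/
theorem exists_pow_eq_mul [Infinite (ResidueField R)] (hdim : 0 < ringKrullDim R) {d n : ℕ}
    {I : Ideal R} {a : Fin d → R} {x : R} (hI : I = span (Set.range a) ⊔ span {x})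
    (h : maximalIdeal R * I ^ (n + 1) ≤ span (Set.range a) * I ^ n)
    (hs : 0 < (maximalIdeal R).spanFinrank) :
    (∃ b : Fin d → R, span (Set.range b) ≤ I ∧ I ^ (n + 1) = span (Set.range b) * I ^ n) ∨
      I ^ ((n + 1) * (maximalIdeal R).spanFinrank) =
        span (Set.range a) * I ^ ((n + 1) * (maximalIdeal R).spanFinrank - 1) := by
  set Q := span (Set.range a) with hQ
  have hQI : Q ≤ I := hI ▸ le_sup_left
  have hx : x ∈ I := hI ▸ Ideal.mem_sup_right (Ideal.mem_span_singleton_self x)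
  have ha : ∀ i, a i ∈ I := fun i => hQI (Ideal.subset_span ⟨i, rfl⟩)
  have hI' : I = span (Set.range (Fin.cons x a : Fin (d + 1) → R)) := by
    rw [Fin.range_cons, Ideal.span_insert, hI, sup_comm]
  by_cases hle : maximalIdeal R * I ^ (n + 1) ≤ maximalIdeal R * (Q * I ^ n)
  · right
    obtain ⟨t, ht, hts⟩ := Submodule.FG.exists_span_finset_card_eq_spanFinrank
      (IsNoetherian.noetherian (maximalIdeal R))
    set s := (maximalIdeal R).spanFinrank
    let z : Fin s → R := fun i => (t.equivFin.trans (finCongr ht)).symm i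
    have hz : span (Set.range z) = maximalIdeal R := by
      rw [← hts]
      congr 1
      have : z = Subtype.val ∘ (t.equivFin.trans (finCongr ht)).symm := rfl
      rw [this, EquivLike.range_comp]
      simp
    have hpos : 0 < (n + 1) * s := Nat.mul_pos n.succ_pos hs
    have hmem := pow_mul_mem_of_forall_mul_mem hdim hQI hz hx (n := n) (fun i => hle (by
      have hzm : z i ∈ maximalIdeal R := hz ▸ Ideal.subset_span ⟨i, rfl⟩
      rw [mul_comm (_ ^ _)]
      exact Ideal.mul_mem_mul hzm (Ideal.pow_mem_pow hx _)))
    obtain ⟨N, hN⟩ : ∃ N, (n + 1) * s = N + 1 := ⟨(n + 1) * s - 1, by lia⟩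
    rw [hN, Nat.add_sub_cancel] at hmem ⊢
    refine le_antisymm ((sup_span_singleton_pow_le Q x hI N).trans
      (sup_le le_rfl ((Ideal.span_singleton_le_iff_mem _).mpr hmem))) ?_
    rw [pow_succ']
    exact Ideal.mul_mono_left hQI
  · left
    obtain ⟨w, hw, hw'⟩ := SetLike.not_le_iff_exists.mp hle
    -- If all coefficients of `F` lay in `𝔪`, its value would lie in `𝔪 Q I^n`, contrary to the
    -- choice of `w`.
    obtain ⟨F, hF, hF0, rfl⟩ := exists_isHomogeneous_of_mem_mul hI' (h hw)
    refine exists_pow_eq_mul_of_eval_mem hI' hF (fun hmap => hw' ?_) hw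
    refine mem_maximalIdeal_mul_of_coeff_mem hx ha hF hF0 fun α => ?_
    rw [← residue_eq_zero_iff, ← MvPolynomial.coeff_map, hmap, MvPolynomial.coeff_zero]

end Local

end IdealReduction

end

theorem proposition3p1 {R : Type*} [CommRing R] [IsLocalRing R] [IsNoetherianRing R]
    [Infinite (IsLocalRing.ResidueField R)]
    (d : ℕ) (hd : 1 ≤ d) (hdim : ringKrullDim R = d)
    (I Q : Ideal R) (hI : IsMPrimary I) (haci : IsAlmostCompleteIntersection I)
    (hQ : IsMinimalReduction Q I)
    (n : ℕ) (hn : 1 ≤ n)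
    (hlen : Module.length R
      (↥(I ^ n) ⧸ Submodule.submoduleOf (Q * I ^ (n - 1)) (I ^ n)) = 1) :
    (reductionNumber I : ℤ) ≤ (n : ℤ) * (idealNu (IsLocalRing.maximalIdeal R) : ℤ) - 1 := by
  obtain ⟨hQI, ⟨d', hd', a, rfl⟩, k, hk⟩ := hQ
  obtain rfl : d = d' := by
    rw [hdim] at hd'
    exact_mod_cast hd'
  obtain ⟨n, rfl⟩ : ∃ m, n = m + 1 := ⟨n - 1, by lia⟩
  rw [Nat.add_sub_cancel] at hlen
  have hdim0 : 0 < ringKrullDim R := by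
    rw [hdim]; exact_mod_cast hd
  have hs : 0 < (IsLocalRing.maximalIdeal R).spanFinrank := by
    have h1 := ringKrullDim_le_spanFinrank_maximalIdeal (R := R)
    rw [hdim] at h1
    have h2 : d ≤ (IsLocalRing.maximalIdeal R).spanFinrank := by exact_mod_cast h1
    lia
  have hν : I.spanFinrank = d + 1 := by
    have h1 : I.height = d := by
      rw [← IdealReduction.radical_height, show I.radical = IsLocalRing.maximalIdeal R from hI,
        ← WithBot.coe_inj, IsLocalRing.maximalIdeal_height_eq_ringKrullDim, hdim]
      rfl
    have h2 : (I.spanFinrank : ℕ∞) = I.height + 1 := haci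
    rw [h1] at h2
    exact_mod_cast h2
  have key : ∀ (b : Fin d → R) (m : ℕ), Ideal.span (Set.range b) ≤ I →
      I ^ (m + 1) = Ideal.span (Set.range b) * I ^ m → reductionNumber I ≤ m := by
    intro b m hb hm
    have h1 : reductionNumber I ≤ relReductionNumber (Ideal.span (Set.range b)) I :=
      Nat.sInf_le ⟨_, ⟨hb, ⟨d, hdim, b, rfl⟩, m, hm⟩, rfl⟩
    exact h1.trans (Nat.sInf_le hm)
  obtain ⟨x, hx⟩ := IdealReduction.exists_eq_sup_span_singleton hI hdim hd hν hQI hk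
  have hpos : 0 < (n + 1) * (IsLocalRing.maximalIdeal R).spanFinrank := Nat.mul_pos n.succ_pos hs
  have hle : reductionNumber I ≤ (n + 1) * (IsLocalRing.maximalIdeal R).spanFinrank - 1 := by
    rcases IdealReduction.exists_pow_eq_mul hdim0 hx
      (IdealReduction.maximalIdeal_mul_le_of_length_eq_one hlen) hs with ⟨b, hb, hbn⟩ | h
    -- The fibre cone alternative gives the bound `n`, which is at most `(n + 1) * s - 1` because `s
    -- ≥ 1`.
    · refine (key b n hb hbn).trans ?_
      have := Nat.le_mul_of_pos_right (n + 1) hs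
      lia
    · refine key a _ hQI ?_
      rwa [Nat.sub_add_cancel hpos]
  have hcast : ((n + 1 : ℕ) : ℤ) * (idealNu (IsLocalRing.maximalIdeal R) : ℤ) =
      (((n + 1) * (IsLocalRing.maximalIdeal R).spanFinrank : ℕ) : ℤ) := by
    rw [Nat.cast_mul]; rfl
  rw [hcast]
  lia
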